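/- **Setting.** Let $n\ge 1$. *Link patterns.* Let $LP(n)$ be the set of link patterns, i.e. non-crossing perfect matchings $\pi$ of $2n$ points on the boundary of a disk, labelled cyclically $1,\dots,2n$ (indices are read modulo $2n$, so the label $0$ is the label $2n$), and let $\pi(i)$ be the point matched to $i$. Let $R$ be the rotation, which replaces every pair $(i,k)$ of $\pi$ by $(i-1,k-1)$. For each $j$ modulo $2n$, let $e_j\pi=\pi$ if $\pi(j)=j+1$, and otherwise let $e_j\pi$ be obtained from $\pi$ by replacing the pairs $(j,\pi(j)),(j+1,\pi(j+1))$ with $(j,j+1),(\pi(j),\pi(j+1))$. Both $R$ and $e_j$ act linearly on $\mathbb{C}^{LP(n)}$, with canonical basis $|\pi\rangle$, by $R|\pi\rangle=|R\pi\rangle$ and $e_j|\pi\rangle=|e_j\pi\rangle$. *Fully-packed loops.* Consider the $n\times n$ square of vertices of the square lattice, with its internal edges and its $4n$ boundary edges. The boundary edges are numbered $1,\dots,4n$ counter-clockwise, starting from the vertical edge below the bottom-left vertex. Let $Fpl(n,+)$ be the set of colourings of all edges in black and white such that every vertex is adjacent to exactly two black and two white edges, and such that the $i$-th boundary edge is black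 for $i$ odd and white for $i$ even. Label the black boundary edge number $2j-1$ by $j$, $1\le j\le 2n$. The link pattern $\pi(\phi)\in LP(n)$ of $\phi\in Fpl(n,+)$ matches two labels if the two black boundary edges are joined by a black path of $\phi$. *Vertex types.* At a vertex, $\phi$ has type $a$ if the left and bottom edges have one colour and the right and top edges the other; type $b$ if the left and top edges have one colour and the right and bottom edges the other; type $c$ if the left and right edges have one colour and the top and bottom edges the other. *States.* For $1\le i\le n$ and $t\in\{a,b,c\}$, let $$|\sigma^{t}_i\rangle=\sum_{\pi\in LP(n)}\Psi^{t}_i(\pi)\,|\pi\rangle ,$$ where $\Psi^t_i(\pi)$ is the number of $\phi\in Fpl(n,+)$ with $\pi(\phi)=\pi$ such that the $i$-th vertex from the left in the bottom row has type $t$. Call $|s^{t}_{\bullet,j}\rangle=|\sigma^t_{2j-1}\rangle$ for $1\le j\le\lceil n/2\rceil$ (odd sites) and $|s^{t}_{\circ,j}\rangle=|\sigma^t_{2j}\rangle$ for $1\le j\le\lfloor n/2\rfloor$ (even sites). **Proposition (Gyration relations).** For every $1\le j\le\lceil n/2\rceil$, $$e_j|s^{a}_{\bullet,j}\rangle=R^{-1}e_{j-1}|s^{a}_{\bullet,j}\rangle,\qquad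 e_j|s^{b}_{\bullet,j}\rangle=R^{-1}e_{j-1}|s^{b}_{\bullet,j}\rangle,\qquad e_j|s^{c}_{\bullet,j}\rangle=R^{-1}e_{j-1}|s^{c}_{\bullet,j}\rangle,$$ and for every $1\le j\le\lfloor n/2\rfloor$, $$e_j|s^{a}_{\circ,j}\rangle=R^{-1}e_{j-1}|s^{a}_{\circ,j}\rangle,\qquad e_j|s^{b}_{\circ,j}\rangle=R\,e_{j+1}|s^{b}_{\circ,j}\rangle .$$ -/

import Mathlib

namespace FPL

/-! ## Link patterns

The `2n` points on the border of the disk are labelled cyclically by `ZMod (2 * n)`; the label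
`j ∈ {1, …, 2n}` is the class of `j`, so that the label `2n` is the class `0`. -/

/-- A link pattern: a non-crossing perfect matching of the `2n` cyclically ordered points.
`partner x` is the point matched to `x`. -/
@[ext]
structure LinkPattern (n : ℕ) [NeZero n] where
  partner : ZMod (2 * n) → ZMod (2 * n)
  partner_partner : ∀ x, partner (partner x) = x
  partner_ne : ∀ x, partner x ≠ x
  noncrossing : ∀ x y, x.val < y.val → y.val < (partner x).val →
    ¬ (partner x).val < (partner y).val

variable {n : ℕ} [NeZero n]

noncomputable instance : Fintype (LinkPattern n) :=
  Fintype.ofInjective LinkPattern.partner fun _ _ h => LinkPattern.ext h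

theorem one_lt_two_mul : 1 < 2 * n := by
  have := NeZero.pos n
  omega

theorem val_add_one_cases (x : ZMod (2 * n)) :
    (x.val + 1 < 2 * n ∧ (x + 1).val = x.val + 1) ∨
      (x.val + 1 = 2 * n ∧ (x + 1).val = 0) := by
  have h1 : (1 : ZMod (2 * n)).val = 1 := by
    rw [ZMod.val_one_eq_one_mod, Nat.mod_eq_of_lt one_lt_two_mul]
  have hx := ZMod.val_lt x
  rw [ZMod.val_add, h1]
  rcases Nat.lt_or_ge (x.val + 1) (2 * n) with h | h
  · exact Or.inl ⟨h, Nat.mod_eq_of_lt h⟩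
  · have h2 : x.val + 1 = 2 * n := by omega
    exact Or.inr ⟨h2, by rw [h2, Nat.mod_self]⟩

/-- The rotation `R`: the pairs `(i, j)` of `π` become the pairs `(i - 1, j - 1)` of `R π`. -/
def rotate (π : LinkPattern n) : LinkPattern n where
  partner x := π.partner (x + 1) - 1
  partner_partner x := by simp [π.partner_partner]
  partner_ne x h := π.partner_ne (x + 1) (sub_eq_iff_eq_add.mp h)
  noncrossing x y hxy hyx hcr := by
    have hp := π.noncrossing (x + 1) (y + 1)
    have hp' := π.noncrossing (π.partner (y + 1)) (x + 1)
    rw [π.partner_partner] at hp'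
    have a1 := val_add_one_cases x
    have a2 := val_add_one_cases y
    have a3 := val_add_one_cases (π.partner (x + 1) - 1)
    have a4 := val_add_one_cases (π.partner (y + 1) - 1)
    simp only [sub_add_cancel] at a3 a4
    omega

/-- The inverse rotation `R⁻¹`: the pairs `(i, j)` of `π` become `(i + 1, j + 1)`. -/
def unrotate (π : LinkPattern n) : LinkPattern n where
  partner x := π.partner (x - 1) + 1
  partner_partner x := by simp [π.partner_partner]
  partner_ne x h := π.partner_ne (x - 1) (by
    have h2 : π.partner (x - 1) + 1 - 1 = x - 1 := by rw [h]
    simpa using h2)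
  noncrossing x y hxy hyx hcr := by
    have hp := π.noncrossing (x - 1) (y - 1)
    have hp' := π.noncrossing (y - 1) (π.partner (x - 1))
    rw [π.partner_partner] at hp'
    have a1 := val_add_one_cases (x - 1)
    have a2 := val_add_one_cases (y - 1)
    have a3 := val_add_one_cases (π.partner (x - 1))
    have a4 := val_add_one_cases (π.partner (y - 1))
    simp only [sub_add_cancel] at a1 a2
    omega

/-- The rotation `R` as a permutation of the set of link patterns. -/
def R : Equiv.Perm (LinkPattern n) where
  toFun := rotate
  invFun := unrotate
  left_inv π := by ext x; simp [rotate, unrotate]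
  right_inv π := by ext x; simp [rotate, unrotate]

/-- The partner map of `e_j π`: connect `j` with `j + 1`, and the former partners of `j` and
`j + 1` with each other (when `π` already matches `j` with `j + 1`, nothing changes). -/
def arcPartner (j : ZMod (2 * n)) (p : ZMod (2 * n) → ZMod (2 * n)) (x : ZMod (2 * n)) :
    ZMod (2 * n) :=
  if p j = j + 1 then p x
  else if x = j then j + 1
  else if x = j + 1 then j
  else if x = p j then p (j + 1)
  else if x = p (j + 1) then p j
  else p x

theorem arcPartner_arcPartner (π : LinkPattern n) (j x : ZMod (2 * n)) :
    arcPartner j π.partner (arcPartner j π.partner x) = x := by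
  have h1 := π.partner_partner
  have h2 := π.partner_ne
  unfold arcPartner
  grind

theorem arcPartner_ne (π : LinkPattern n) (j x : ZMod (2 * n)) :
    arcPartner j π.partner x ≠ x := by
  have h1 := π.partner_partner
  have h2 := π.partner_ne
  have h3 : (1 : ZMod (2 * n)) ≠ 0 := by
    intro h
    have h4 := congrArg ZMod.val h
    rw [ZMod.val_one_eq_one_mod, Nat.mod_eq_of_lt one_lt_two_mul, ZMod.val_zero] at h4
    omega
  have h5 : j + 1 ≠ j := by simpa using h3
  unfold arcPartner
  grind

theorem arcPartner_zero_noncrossing (π : LinkPattern n) (x y : ZMod (2 * n))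
    (hxy : x.val < y.val) (hyx : y.val < (arcPartner 0 π.partner x).val) :
    ¬ (arcPartner 0 π.partner x).val < (arcPartner 0 π.partner y).val := by
  have h1 := π.partner_partner
  have v0 : (0 : ZMod (2 * n)).val = 0 := ZMod.val_zero
  have v1 : (1 : ZMod (2 * n)).val = 1 := by
    rw [ZMod.val_one_eq_one_mod, Nat.mod_eq_of_lt one_lt_two_mul]
  have inj : ∀ a b : ZMod (2 * n), a.val = b.val → a = b := fun a b h => ZMod.val_injective _ h
  have hnc := π.noncrossing
  revert hyx
  simp only [arcPartner, zero_add]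
  have i0 := inj x 0
  have i1 := inj x 1
  have k0 := inj y 0
  have k1 := inj y 1
  have c1 := hnc x y
  have c2 := hnc x (π.partner 0)
  have c3 := hnc x (π.partner 1)
  have c4 := hnc y (π.partner 0)
  have c5 := hnc y (π.partner 1)
  have c6 := hnc 0 x
  have c7 := hnc 0 y
  have c8 := hnc 1 x
  have c9 := hnc 1 y
  have c10 := hnc 0 1
  have c11 := inj (π.partner 0) 0
  have c12 := inj (π.partner 0) 1
  have c13 := inj (π.partner 1) 0
  have c14 := inj (π.partner 1) 1
  have c15 := π.partner_ne 0
  have c16 := π.partner_ne 1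
  have c17 := h1 0
  have c18 := h1 1
  have c19 := inj x (π.partner 0)
  have c20 := inj x (π.partner 1)
  have c21 := inj y (π.partner 0)
  have c22 := inj y (π.partner 1)
  split_ifs <;> grind

/-- The Temperley-Lieb map `e_j` on link patterns. -/
def e (j : ZMod (2 * n)) (π : LinkPattern n) : LinkPattern n where
  partner := arcPartner j π.partner
  partner_partner := arcPartner_arcPartner π j
  partner_ne := arcPartner_ne π j
  noncrossing := by
    have key : ∀ (k : ℕ) (π : LinkPattern n), ∃ ρ : LinkPattern n,
        ρ.partner = arcPartner (k : ZMod (2 * n)) π.partner := by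
      intro k
      induction k with
      | zero =>
        intro π
        exact ⟨⟨arcPartner 0 π.partner, arcPartner_arcPartner π 0, arcPartner_ne π 0,
          arcPartner_zero_noncrossing π⟩, by simp⟩
      | succ k ih =>
        intro π
        obtain ⟨ρ, hρ⟩ := ih (rotate π)
        refine ⟨unrotate ρ, ?_⟩
        funext x
        simp only [unrotate, hρ, arcPartner, rotate, sub_add_cancel, sub_eq_iff_eq_add,
          Nat.cast_add, Nat.cast_one]
        split_ifs <;> simp_all
    obtain ⟨ρ, hρ⟩ := key j.val π
    rw [ZMod.natCast_zmod_val] at hρ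
    rw [← hρ]
    exact ρ.noncrossing

/-! ## The vector space `ℂ^{LP(n)}` and the operators on it -/

/-- The formal complex vectors on link patterns. The basis vector `|π⟩` is
`Finsupp.single π 1`. -/
abbrev LPSpace (n : ℕ) [NeZero n] := LinkPattern n →₀ ℂ

/-- The operator `e_j`, with `e_j |π⟩ = |e_j π⟩`. -/
noncomputable def eOp (j : ZMod (2 * n)) : LPSpace n →ₗ[ℂ] LPSpace n :=
  Finsupp.lmapDomain ℂ ℂ (e j)

/-- The invertible operator `R`, with `R |π⟩ = |R π⟩`. -/
noncomputable def ROp : LPSpace n ≃ₗ[ℂ] LPSpace n :=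
  Finsupp.domLCongr R

end FPL

namespace FPL

/-! ## Fully-packed loops on the `n × n` square

The vertex `(r, c)` lies in the `r`-th row from the bottom and the `c`-th column from the left,
both counted from `0`. -/

/-- The edges of the `n × n` square, boundary edges included. `Sum.inl (r, k)` is the horizontal
edge of row `r` between the columns `k - 1` and `k`; `Sum.inr (k, c)` is the vertical edge of
column `c` between the rows `k - 1` and `k`. The values `k = 0` and `k = n` give the boundary
edges. -/
abbrev Edge (n : ℕ) := (Fin n × Fin (n + 1)) ⊕ (Fin (n + 1) × Fin n)

abbrev Vertex (n : ℕ) := Fin n × Fin n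

def leftEdge {n : ℕ} (v : Vertex n) : Edge n := Sum.inl (v.1, v.2.castSucc)

def rightEdge {n : ℕ} (v : Vertex n) : Edge n := Sum.inl (v.1, v.2.succ)

def bottomEdge {n : ℕ} (v : Vertex n) : Edge n := Sum.inr (v.1.castSucc, v.2)

def topEdge {n : ℕ} (v : Vertex n) : Edge n := Sum.inr (v.1.succ, v.2)

/-- The four edges adjacent to a vertex. -/
def star {n : ℕ} (v : Vertex n) : Finset (Edge n) :=
  {leftEdge v, rightEdge v, bottomEdge v, topEdge v}

/-- The two colours `b` (black) and `w` (white). -/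
inductive Colour
  | b
  | w
  deriving DecidableEq

instance : Fintype Colour := ⟨{Colour.b, Colour.w}, fun x => by cases x <;> simp⟩

/-- The ice rule: each vertex is adjacent to two black and two white edges. -/
def IceRule {n : ℕ} (φ : Edge n → Colour) : Prop :=
  ∀ v : Vertex n, ((star v).filter fun e => φ e = Colour.b).card = 2 ∧
    ((star v).filter fun e => φ e = Colour.w).card = 2

/-- The `4n` boundary edges in counter-clockwise order, starting with the bottom edge of the
bottom-left vertex: the bottom side from left to right, the right side upwards, the top side from
right to left, the left side downwards. -/
def boundaryEdge {n : ℕ} (k : Fin (4 * n)) : Edge n :=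
  if h₁ : k.val < n then Sum.inr (0, ⟨k.val, h₁⟩)
  else if h₂ : k.val < 2 * n then Sum.inl (⟨k.val - n, by omega⟩, Fin.last n)
  else if h₃ : k.val < 3 * n then Sum.inr (Fin.last n, ⟨3 * n - 1 - k.val, by omega⟩)
  else Sum.inl (⟨4 * n - 1 - k.val, by omega⟩, 0)

/-- The alternating boundary condition `τ₊ = (bwbw…bw)`. -/
def tauPlus {n : ℕ} (k : Fin (4 * n)) : Colour :=
  if k.val % 2 = 0 then Colour.b else Colour.w

/-- The ensemble `Fpl(n, +)`. -/
def Fpl (n : ℕ) : Set (Edge n → Colour) :=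
  {φ | IceRule φ ∧ ∀ k : Fin (4 * n), φ (boundaryEdge k) = tauPlus k}

/-- Two black edges of `φ` with a common vertex: consecutive steps of a black path or cycle. -/
def BlackStep {n : ℕ} (φ : Edge n → Colour) (e e' : Edge n) : Prop :=
  φ e = Colour.b ∧ φ e' = Colour.b ∧ ∃ v : Vertex n, e ∈ star v ∧ e' ∈ star v

/-- The edges `e` and `e'` lie on the same black path or cycle of `φ`. -/
def BlackConnected {n : ℕ} (φ : Edge n → Colour) : Edge n → Edge n → Prop :=
  Relation.ReflTransGen (BlackStep φ)

/-- The black endpoint with label `x`. For `1 ≤ j ≤ 2n`, the label `j` is carried by the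
`(2j - 1)`-th boundary edge, which is the edge number `2 (j - 1)` when counted from `0`. -/
def blackEnd {n : ℕ} [NeZero n] (x : ZMod (2 * n)) : Edge n :=
  boundaryEdge ⟨2 * (x - 1).val, by have := ZMod.val_lt (x - 1); omega⟩

/-- `π(φ) = π`: the link pattern `π` matches two distinct black endpoints exactly if a black path
of `φ` connects them. -/
def HasLinkPattern {n : ℕ} [NeZero n] (φ : Edge n → Colour) (π : LinkPattern n) : Prop :=
  ∀ x y : ZMod (2 * n), π.partner x = y ↔ x ≠ y ∧ BlackConnected φ (blackEnd x) (blackEnd y)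

/-! ## The refined states -/

/-- The three types of configurations of the six-vertex model. -/
inductive VertexType
  | a
  | b
  | c
  deriving DecidableEq

/-- The configuration of `φ` at `v` has the given type. In type `c` the two black edges are
opposite; in types `a` and `b` the black line turns: the two pairs of equally coloured edges are
left–bottom and right–top in type `a`, and left–top and right–bottom in type `b`. -/
def HasType {n : ℕ} (φ : Edge n → Colour) (v : Vertex n) : VertexType → Prop
  | .a => φ (leftEdge v) = φ (bottomEdge v) ∧ φ (rightEdge v) = φ (topEdge v) ∧
      φ (leftEdge v) ≠ φ (rightEdge v)
  | .b => φ (leftEdge v) = φ (topEdge v) ∧ φ (rightEdge v) = φ (bottomEdge v) ∧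
      φ (leftEdge v) ≠ φ (rightEdge v)
  | .c => φ (leftEdge v) = φ (rightEdge v) ∧ φ (bottomEdge v) = φ (topEdge v) ∧
      φ (leftEdge v) ≠ φ (bottomEdge v)

/-- The number of FPL in `Fpl(n, +)` with link pattern `π` whose bottom-row vertex in column `c`
has type `t`. -/
noncomputable def Psi {n : ℕ} [NeZero n] (c : Fin n) (t : VertexType) (π : LinkPattern n) : ℕ :=
  Set.ncard {φ : Edge n → Colour | φ ∈ Fpl n ∧ HasType φ (0, c) t ∧ HasLinkPattern φ π}

/-- The state `∑_π Ψ(π) |π⟩` of `Fpl(n, +)` restricted to type `t` at the bottom-row vertex in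
column `c`. -/
noncomputable def state {n : ℕ} [NeZero n] (c : Fin n) (t : VertexType) : LPSpace n :=
  ∑ π : LinkPattern n, Finsupp.single π (Psi c t π : ℂ)

/-- The state restricted to type `t` at the `(2j - 1)`-th vertex of the bottom row,
`1 ≤ j ≤ ⌈n / 2⌉`. -/
noncomputable def oddState {n : ℕ} [NeZero n] (t : VertexType) (j : ℕ) (h₁ : 1 ≤ j)
    (h₂ : j ≤ (n + 1) / 2) : LPSpace n :=
  state ⟨(2 * j - 1) - 1, by omega⟩ t

/-- The state restricted to type `t` at the `2j`-th vertex of the bottom row,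
`1 ≤ j ≤ ⌊n / 2⌋`. -/
noncomputable def evenState {n : ℕ} [NeZero n] (t : VertexType) (j : ℕ) (h₁ : 1 ≤ j)
    (h₂ : j ≤ n / 2) : LPSpace n :=
  state ⟨2 * j - 1, by omega⟩ t

end FPL

/-! The proof localises Wieland's gyration at one vertex of the bottom row. Split the faces of the
grid, border faces included, into two parities; each edge lies in one cell of each parity. A half
gyration exchanges the colours in all cells of one parity except the alternating ones. It is an
involution, keeps the ice rule and interchanges the two alternating boundary conditions. It also
keeps the black connections (`blackConnected_gyrate`), because black edges of a non-alternating cell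
are always connected (`blackConnected_of_cell_eq`). A black end moves to its neighbour in the same
border cell, so parity 1 keeps the link pattern and parity 0 rotates it.

To keep the type of a bottom vertex, `step` first exchanges the colours of one adjacent cell `(1,
k)` if it is alternating, so that this cell is flipped in every case. The other cell of that parity
at the vertex is a border cell, which is always flipped. All four edges at the vertex change colour
and its type survives. The price is a change of the link pattern that a suitable `e_y` does not see
(`e_eq_of_swapCell`).

Two maps of opposite parity permute the colourings with prescribed type, and the relation follows by
reindexing the state (`mapDomain_state_eq`). At an odd site the first swap is absorbed by `e_j`, the
rotation turns this into `e_{j-1}`, and the second swap is absorbed by exactly that operator. At an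
even site the second swap would need another index, but in types `a` and `b` the second cell is not
alternating, provided that the parities come in the right order. This order decides between `R⁻¹`
and `R`.

The link pattern itself exists by a count of path ends and a discrete Jordan argument modulo 2
(`exists_other_end`, `not_crossing`). -/

namespace FPL

/-! ## Colours, vertices and the ice rule -/

/-- The opposite colour. -/
def Colour.flip : Colour → Colour
  | .b => .w
  | .w => .b

@[simp] theorem Colour.flip_flip (x : Colour) : x.flip.flip = x := by cases x <;> rfl

@[simp] theorem Colour.flip_inj {x y : Colour} : x.flip = y.flip ↔ x = y := by
  cases x <;> cases y <;> simp [Colour.flip]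

theorem Colour.flip_eq_iff {x y : Colour} : x.flip = y ↔ x ≠ y := by
  cases x <;> cases y <;> simp [Colour.flip]

theorem Colour.ne_b {x : Colour} : x ≠ .b ↔ x = .w := by cases x <;> simp

theorem mem_star {n : ℕ} {v : Vertex n} {e : Edge n} :
    e ∈ star v ↔ e = leftEdge v ∨ e = rightEdge v ∨ e = bottomEdge v ∨ e = topEdge v := by
  simp [star]

theorem exists_hasType_iff {n : ℕ} {φ : Edge n → Colour} {v : Vertex n} :
    (∃ t, HasType φ v t) ↔ HasType φ v .a ∨ HasType φ v .b ∨ HasType φ v .c := by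
  constructor
  · rintro ⟨t, h⟩
    cases t <;> simp [h]
  · rintro (h | h | h)
    exacts [⟨_, h⟩, ⟨_, h⟩, ⟨_, h⟩]

theorem iceRule_iff {n : ℕ} {φ : Edge n → Colour} :
    IceRule φ ↔ ∀ v, ∃ t, HasType φ v t := by
  refine forall_congr' fun v => ?_
  have h1 : leftEdge v ≠ rightEdge v := by simp [leftEdge, rightEdge, Fin.ext_iff]
  have h2 : bottomEdge v ≠ topEdge v := by simp [bottomEdge, topEdge, Fin.ext_iff]
  have h3 : leftEdge v ≠ bottomEdge v := by simp [leftEdge, bottomEdge]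
  have h4 : leftEdge v ≠ topEdge v := by simp [leftEdge, topEdge]
  have h5 : rightEdge v ≠ bottomEdge v := by simp [rightEdge, bottomEdge]
  have h6 : rightEdge v ≠ topEdge v := by simp [rightEdge, topEdge]
  rw [exists_hasType_iff]
  unfold star
  simp only [HasType, Finset.filter_insert, Finset.filter_singleton]
  cases φ (leftEdge v) <;> cases φ (rightEdge v) <;> cases φ (bottomEdge v) <;>
    cases φ (topEdge v) <;> simp [*]

/-! ## Cells

The cell `(r, c)`, `0 ≤ r, c ≤ n`, is the face with the corners `(r - 1, c - 1)`, `(r - 1, c)`,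
`(r, c - 1)` and `(r, c)`, as far as they exist. Each edge belongs to exactly one cell of each
parity. -/

/-- The cell of parity `ε` that contains the given edge. -/
def cell {n : ℕ} (ε : ℕ) : Edge n → ℕ × ℕ
  | .inl (r, k) => if (r.val + k.val) % 2 = ε % 2 then (r, k) else (r + 1, k)
  | .inr (k, c) => if (k.val + c.val) % 2 = ε % 2 then (k, c) else (k, c + 1)

/-- The edges `p`, `q`, `p'`, `q'` are the edges at `v`; `p` and `q` belong to one cell of parity
`ε`, `p'` and `q'` to another one. -/
structure IsQuad {n : ℕ} (ε : ℕ) (v : Vertex n) (p q p' q' : Edge n) : Prop where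
  mem : ∀ e, e ∈ star v ↔ e = p ∨ e = q ∨ e = p' ∨ e = q'
  cell_eq : cell ε p = cell ε q
  cell_eq' : cell ε p' = cell ε q'
  ne : p ≠ q
  ne' : p' ≠ q'
  ice : ∀ φ : Edge n → Colour, (∃ t, HasType φ v t) ↔
    (φ p ≠ φ q ∧ φ p' ≠ φ q') ∨ (φ p = φ q ∧ φ p' = φ q' ∧ φ p ≠ φ p')

theorem IsQuad.symm {n : ℕ} {ε : ℕ} {v : Vertex n} {p q p' q' : Edge n}
    (h : IsQuad ε v p q p' q') : IsQuad ε v p' q' p q where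
  mem e := by rw [h.mem]; tauto
  cell_eq := h.cell_eq'
  cell_eq' := h.cell_eq
  ne := h.ne'
  ne' := h.ne
  ice φ := by rw [h.ice]; grind

/-- The two cells of parity `ε` around a vertex are diagonally opposite; the parity of the vertex
decides which diagonal they occupy. -/
theorem cell_of_even {n : ℕ} {ε : ℕ} {v : Vertex n} (h : (v.1.val + v.2.val) % 2 = ε % 2) :
    cell ε (leftEdge v) = (v.1.val, v.2.val) ∧ cell ε (bottomEdge v) = (v.1.val, v.2.val) ∧
    cell ε (rightEdge v) = (v.1.val + 1, v.2.val + 1) ∧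
    cell ε (topEdge v) = (v.1.val + 1, v.2.val + 1) := by
  simp only [cell, leftEdge, rightEdge, bottomEdge, topEdge, Fin.val_castSucc, Fin.val_succ]
  refine ⟨?_, ?_, ?_, ?_⟩ <;> split_ifs <;> first | rfl | omega

theorem cell_of_odd {n : ℕ} {ε : ℕ} {v : Vertex n} (h : (v.1.val + v.2.val) % 2 ≠ ε % 2) :
    cell ε (leftEdge v) = (v.1.val + 1, v.2.val) ∧ cell ε (topEdge v) = (v.1.val + 1, v.2.val) ∧
    cell ε (rightEdge v) = (v.1.val, v.2.val + 1) ∧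
    cell ε (bottomEdge v) = (v.1.val, v.2.val + 1) := by
  simp only [cell, leftEdge, rightEdge, bottomEdge, topEdge, Fin.val_castSucc, Fin.val_succ]
  refine ⟨?_, ?_, ?_, ?_⟩ <;> split_ifs <;> first | rfl | omega

theorem isQuad_of_even {n : ℕ} {ε : ℕ} {v : Vertex n} (h : (v.1.val + v.2.val) % 2 = ε % 2) :
    IsQuad ε v (leftEdge v) (bottomEdge v) (rightEdge v) (topEdge v) := by
  obtain ⟨h1, h2, h3, h4⟩ := cell_of_even h
  refine ⟨fun e => by rw [mem_star]; tauto,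
    h1.trans h2.symm, h3.trans h4.symm, by simp [leftEdge, bottomEdge],
    by simp [rightEdge, topEdge], fun φ => ?_⟩
  rw [exists_hasType_iff]
  simp only [HasType]
  cases φ (leftEdge v) <;> cases φ (rightEdge v) <;> cases φ (bottomEdge v) <;>
    cases φ (topEdge v) <;> simp

theorem isQuad_of_odd {n : ℕ} {ε : ℕ} {v : Vertex n} (h : (v.1.val + v.2.val) % 2 ≠ ε % 2) :
    IsQuad ε v (leftEdge v) (topEdge v) (rightEdge v) (bottomEdge v) := by
  obtain ⟨h1, h2, h3, h4⟩ := cell_of_odd h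
  refine ⟨fun e => by rw [mem_star]; tauto,
    h1.trans h2.symm, h3.trans h4.symm, by simp [leftEdge, topEdge],
    by simp [rightEdge, bottomEdge], fun φ => ?_⟩
  rw [exists_hasType_iff]
  simp only [HasType]
  cases φ (leftEdge v) <;> cases φ (rightEdge v) <;> cases φ (bottomEdge v) <;>
    cases φ (topEdge v) <;> simp

theorem exists_isQuad {n : ℕ} (ε : ℕ) (v : Vertex n) : ∃ p q p' q', IsQuad ε v p q p' q' := by
  by_cases h : (v.1.val + v.2.val) % 2 = ε % 2
  · exact ⟨_, _, _, _, isQuad_of_even h⟩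
  · exact ⟨_, _, _, _, isQuad_of_odd h⟩

/-- The cell `P` is an inner one, and its four edges are coloured alternately. -/
def Alt {n : ℕ} (φ : Edge n → Colour) (P : ℕ × ℕ) : Prop :=
  ∃ (r c : ℕ) (hr : r + 1 < n) (hc : c + 1 < n), P = (r + 1, c + 1) ∧
    φ (.inl (⟨r, by omega⟩, ⟨c + 1, by omega⟩)) = φ (.inl (⟨r + 1, hr⟩, ⟨c + 1, by omega⟩)) ∧
    φ (.inr (⟨r + 1, by omega⟩, ⟨c, by omega⟩)) = φ (.inr (⟨r + 1, by omega⟩, ⟨c + 1, hc⟩)) ∧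
    φ (.inl (⟨r, by omega⟩, ⟨c + 1, by omega⟩)) ≠ φ (.inr (⟨r + 1, by omega⟩, ⟨c, by omega⟩))

theorem Alt.congr {n : ℕ} {φ ψ : Edge n → Colour} {P : ℕ × ℕ} {ε : ℕ} (h : Alt φ P)
    (hε : (P.1 + P.2) % 2 = ε % 2)
    (hψ : (∀ e, cell ε e = P → ψ e = φ e) ∨ (∀ e, cell ε e = P → ψ e = (φ e).flip)) :
    Alt ψ P := by
  obtain ⟨r, c, hr, hc, rfl, h1, h2, h3⟩ := h
  refine ⟨r, c, hr, hc, rfl, ?_⟩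
  have key : ∀ e : Edge n, e = .inl (⟨r, by omega⟩, ⟨c + 1, by omega⟩) ∨
      e = .inl (⟨r + 1, hr⟩, ⟨c + 1, by omega⟩) ∨ e = .inr (⟨r + 1, by omega⟩, ⟨c, by omega⟩) ∨
      e = .inr (⟨r + 1, by omega⟩, ⟨c + 1, hc⟩) → cell ε e = (r + 1, c + 1) := by
    rintro e (rfl | rfl | rfl | rfl) <;> simp only [cell] <;> split_ifs <;>
      first | rfl | (simp only at hε; omega)
  rcases hψ with hψ | hψ
  · rw [hψ _ (key _ (by simp)), hψ _ (key _ (by simp)), hψ _ (key _ (by simp)),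
      hψ _ (key _ (by simp))]
    exact ⟨h1, h2, h3⟩
  · rw [hψ _ (key _ (by simp)), hψ _ (key _ (by simp)), hψ _ (key _ (by simp)),
      hψ _ (key _ (by simp))]
    simpa using ⟨h1, h2, h3⟩

/-- Two edges of a cell that meet at a corner are consecutive in the alternation. Mostly used
contrapositively: a monochromatic pair at a vertex rules out an alternating cell. -/
theorem Alt.ne {n : ℕ} {φ : Edge n → Colour} {ε : ℕ} {v : Vertex n} {p q p' q' : Edge n}
    (hq : IsQuad ε v p q p' q') (h : Alt φ (cell ε p)) : φ p ≠ φ q := by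
  have hp := (hq.mem p).2 (by simp)
  have hq' := (hq.mem q).2 (by simp)
  obtain ⟨r, c, hr, hc, hP, h1, h2, h3⟩ := h
  have hP' := hq.cell_eq ▸ hP
  have hne := hq.ne
  obtain ⟨⟨vr, hvr⟩, ⟨vc, hvc⟩⟩ := v
  rw [mem_star] at hp hq'
  have key : ∀ e : Edge n,
      (e = leftEdge (⟨vr, hvr⟩, ⟨vc, hvc⟩) ∨ e = rightEdge (⟨vr, hvr⟩, ⟨vc, hvc⟩) ∨
      e = bottomEdge (⟨vr, hvr⟩, ⟨vc, hvc⟩) ∨ e = topEdge (⟨vr, hvr⟩, ⟨vc, hvc⟩)) →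
      cell ε e = (r + 1, c + 1) →
      e = .inl (⟨r, by omega⟩, ⟨c + 1, by omega⟩) ∧ (vr = r) ∨
      e = .inl (⟨r + 1, hr⟩, ⟨c + 1, by omega⟩) ∧ vr = r + 1 ∨
      e = .inr (⟨r + 1, by omega⟩, ⟨c, by omega⟩) ∧ vc = c ∨
      e = .inr (⟨r + 1, by omega⟩, ⟨c + 1, hc⟩) ∧ vc = c + 1 := by
    rintro e (rfl | rfl | rfl | rfl) <;>
      simp only [cell, leftEdge, rightEdge, bottomEdge, topEdge] <;> split_ifs <;>
      simp [Fin.ext_iff] <;> omega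
  rcases key p hp hP with ⟨rfl, h4⟩ | ⟨rfl, h4⟩ | ⟨rfl, h4⟩ | ⟨rfl, h4⟩ <;>
  rcases key q hq' hP' with ⟨rfl, h5⟩ | ⟨rfl, h5⟩ | ⟨rfl, h5⟩ | ⟨rfl, h5⟩ <;>
  first
  | exact absurd rfl hne
  | (exfalso; omega)
  | grind

theorem cell_parity {n : ℕ} (ε : ℕ) (e : Edge n) :
    ((cell ε e).1 + (cell ε e).2) % 2 = ε % 2 := by
  rcases e with ⟨r, k⟩ | ⟨k, c⟩ <;> simp only [cell] <;> split_ifs <;> simp only <;> omega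

theorem cell_congr {n : ℕ} {ε ε' : ℕ} (h : ε % 2 = ε' % 2) (e : Edge n) : cell ε e = cell ε' e := by
  rcases e with ⟨r, k⟩ | ⟨k, c⟩ <;> simp only [cell, h]

/-! ## Flipping cells -/

open Classical in
/-- Exchange the colours in the cells of parity `ε` that satisfy `F`. -/
noncomputable def flipCells {n : ℕ} (ε : ℕ) (F : ℕ × ℕ → Prop) (φ : Edge n → Colour) :
    Edge n → Colour :=
  fun e => if F (cell ε e) then (φ e).flip else φ e

/-- A pair with two colours keeps two colours when its cell is flipped. If both pairs at a vertex
are monochromatic, they stay opposite only when both cells are flipped or neither is; this is the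
hypothesis `hF`. -/
theorem IceRule.flipCells {n : ℕ} {ε : ℕ} {F : ℕ × ℕ → Prop} {φ : Edge n → Colour}
    (hφ : IceRule φ)
    (hF : ∀ v p q p' q', IsQuad ε v p q p' q' → φ p = φ q → (F (cell ε p) ↔ F (cell ε p'))) :
    IceRule (flipCells ε F φ) := by
  rw [iceRule_iff] at hφ ⊢
  intro v
  obtain ⟨p, q, p', q', hq⟩ := exists_isQuad ε v
  have h1 := hφ v
  have h2 := hF v p q p' q' hq
  have h3 := hq.cell_eq
  have h4 := hq.cell_eq'
  rw [hq.ice] at h1 ⊢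
  simp only [FPL.flipCells]
  rcases h1 with ⟨h5, h6⟩ | ⟨h5, h6, h7⟩
  · left
    rw [h3, h4]
    constructor <;> split_ifs <;> simpa
  · right
    rw [← h3, ← h4]
    by_cases h8 : F (cell ε p)
    · have h9 := (h2 h5).1 h8
      simp [h8, h9, h5, h6]
      grind
    · have h9 : ¬ F (cell ε p') := fun h => h8 ((h2 h5).2 h)
      simp [h8, h9, h5, h6]
      grind

/-- Half gyration: exchange the colours in the cells of parity `ε`, except for the alternating
cells. -/
noncomputable def gyrate {n : ℕ} (ε : ℕ) (φ : Edge n → Colour) : Edge n → Colour :=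
  flipCells ε (fun P => ¬ Alt φ P) φ

/-- Exchange the colours in the cell `P` if it is alternating. -/
noncomputable def swapCell {n : ℕ} (P : ℕ × ℕ) (φ : Edge n → Colour) : Edge n → Colour :=
  flipCells (P.1 + P.2) (fun Q => Q = P ∧ Alt φ P) φ

theorem gyrate_of_alt {n : ℕ} {ε : ℕ} {φ : Edge n → Colour} {e : Edge n}
    (h : Alt φ (cell ε e)) : gyrate ε φ e = φ e := by
  simp [gyrate, flipCells, h]

theorem gyrate_of_not_alt {n : ℕ} {ε : ℕ} {φ : Edge n → Colour} {e : Edge n}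
    (h : ¬ Alt φ (cell ε e)) : gyrate ε φ e = (φ e).flip := by
  simp [gyrate, flipCells, h]

theorem swapCell_of_not_alt {n : ℕ} {P : ℕ × ℕ} {φ : Edge n → Colour} (h : ¬ Alt φ P) :
    swapCell P φ = φ := by
  funext e
  simp [swapCell, flipCells, h]

theorem swapCell_of_cell_ne {n : ℕ} {P : ℕ × ℕ} {φ : Edge n → Colour} {e : Edge n}
    (h : cell (P.1 + P.2) e ≠ P) : swapCell P φ e = φ e := by
  simp [swapCell, flipCells, h]

theorem swapCell_of_alt {n : ℕ} {P : ℕ × ℕ} {φ : Edge n → Colour} {e : Edge n}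
    (h : Alt φ P) (he : cell (P.1 + P.2) e = P) : swapCell P φ e = (φ e).flip := by
  simp [swapCell, flipCells, h, he]

theorem alt_gyrate {n : ℕ} {ε : ℕ} {φ : Edge n → Colour} {P : ℕ × ℕ}
    (hε : (P.1 + P.2) % 2 = ε % 2) : Alt (gyrate ε φ) P ↔ Alt φ P := by
  by_cases h : Alt φ P
  · refine iff_of_true (h.congr hε (.inl fun e he => ?_)) h
    exact gyrate_of_alt (he ▸ h)
  · refine iff_of_false (fun h' => h (h'.congr hε (.inr fun e he => ?_))) h
    rw [gyrate_of_not_alt (he ▸ h), Colour.flip_flip]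

theorem alt_swapCell {n : ℕ} {φ : Edge n → Colour} {P : ℕ × ℕ} :
    Alt (swapCell P φ) P ↔ Alt φ P := by
  by_cases h : Alt φ P
  · exact iff_of_true (h.congr rfl (.inr fun e he => swapCell_of_alt h he)) h
  · rw [swapCell_of_not_alt h]

/-- Half gyration does not change which cells of parity `ε` are alternating, so the same edges are
flipped twice. -/
theorem gyrate_gyrate {n : ℕ} (ε : ℕ) (φ : Edge n → Colour) : gyrate ε (gyrate ε φ) = φ := by
  funext e
  have h' := alt_gyrate (φ := φ) (cell_parity ε e)
  by_cases h : Alt φ (cell ε e)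
  · rw [gyrate_of_alt (h'.2 h), gyrate_of_alt h]
  · rw [gyrate_of_not_alt (h'.not.2 h), gyrate_of_not_alt h, Colour.flip_flip]

theorem swapCell_swapCell {n : ℕ} (P : ℕ × ℕ) (φ : Edge n → Colour) :
    swapCell P (swapCell P φ) = φ := by
  by_cases h : Alt φ P
  · funext e
    by_cases he : cell (P.1 + P.2) e = P
    · rw [swapCell_of_alt (alt_swapCell.2 h) he, swapCell_of_alt h he, Colour.flip_flip]
    · rw [swapCell_of_cell_ne he, swapCell_of_cell_ne he]
  · rw [swapCell_of_not_alt (alt_swapCell.not.2 h), swapCell_of_not_alt h]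

theorem gyrate_injective {n : ℕ} (ε : ℕ) :
    Function.Injective (gyrate ε : (Edge n → Colour) → Edge n → Colour) :=
  Function.LeftInverse.injective (gyrate_gyrate ε)

theorem swapCell_injective {n : ℕ} (P : ℕ × ℕ) :
    Function.Injective (swapCell P : (Edge n → Colour) → Edge n → Colour) :=
  Function.LeftInverse.injective (swapCell_swapCell P)

theorem IceRule.gyrate {n : ℕ} {φ : Edge n → Colour} (hφ : IceRule φ) (ε : ℕ) :
    IceRule (gyrate ε φ) := by
  refine hφ.flipCells fun v p q p' q' hq hpq => ?_
  have h1 : ¬ Alt φ (cell ε p) := fun h => h.ne hq hpq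
  have h2 : ¬ Alt φ (cell ε p') := fun h => by
    have := (hq.ice φ).1 (iceRule_iff.1 hφ v)
    have := h.ne hq.symm
    grind
  simp [h1, h2]

theorem IceRule.swapCell {n : ℕ} {φ : Edge n → Colour} (hφ : IceRule φ) (P : ℕ × ℕ) :
    IceRule (swapCell P φ) := by
  refine hφ.flipCells fun v p q p' q' hq hpq => ?_
  have h1 : ¬ Alt φ (cell (P.1 + P.2) p) := fun h => h.ne hq hpq
  have h2 : ¬ Alt φ (cell (P.1 + P.2) p') := fun h => by
    have := (hq.ice φ).1 (iceRule_iff.1 hφ v)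
    have := h.ne hq.symm
    grind
  refine iff_of_false ?_ ?_
  · rintro ⟨h, h'⟩
    exact h1 (h.symm ▸ h')
  · rintro ⟨h, h'⟩
    exact h2 (h.symm ▸ h')

/-! ## The two alternating boundary conditions -/

/-- The fully-packed loops whose `k`-th boundary edge, counted from `0`, is black exactly if `k` has
the parity of `s`. -/
def FplAt (n s : ℕ) : Set (Edge n → Colour) :=
  {φ | IceRule φ ∧ ∀ k : Fin (4 * n), φ (boundaryEdge k) = Colour.b ↔ k.val % 2 = s % 2}

theorem fplAt_zero (n : ℕ) : FplAt n 0 = Fpl n := by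
  ext φ
  refine and_congr_right fun _ => forall_congr' fun k => ?_
  rw [tauPlus]
  split_ifs with h <;> simp [h, Colour.ne_b]

theorem boundaryEdge_bottom {n : ℕ} (c : Fin n) :
    boundaryEdge ⟨c.val, by omega⟩ = (.inr (0, c) : Edge n) := by
  simp [boundaryEdge]

theorem boundaryEdge_right {n : ℕ} (r : Fin n) :
    boundaryEdge ⟨n + r.val, by omega⟩ = (.inl (r, Fin.last n) : Edge n) := by
  have h1 : ¬ (n + r.val < n) := by omega
  have h2 : n + r.val < 2 * n := by omega
  simp [boundaryEdge, h2]

theorem boundaryEdge_top {n : ℕ} (c : Fin n) :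
    boundaryEdge ⟨3 * n - 1 - c.val, by omega⟩ = (.inr (Fin.last n, c) : Edge n) := by
  have h1 : ¬ (3 * n - 1 - c.val < n) := by omega
  have h2 : ¬ (3 * n - 1 - c.val < 2 * n) := by omega
  have h3 : 3 * n - 1 - c.val < 3 * n := by omega
  simp only [boundaryEdge, h1, h2, h3, dite_true, dite_false]
  congr 3
  omega

theorem boundaryEdge_left {n : ℕ} (r : Fin n) :
    boundaryEdge ⟨4 * n - 1 - r.val, by omega⟩ = (.inl (r, 0) : Edge n) := by
  have h1 : ¬ (4 * n - 1 - r.val < n) := by omega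
  have h2 : ¬ (4 * n - 1 - r.val < 2 * n) := by omega
  have h3 : ¬ (4 * n - 1 - r.val < 3 * n) := by omega
  simp only [boundaryEdge, h1, h2, h3, dite_false]
  congr 3
  omega

theorem boundaryEdge_cases {n : ℕ} (k : Fin (4 * n)) :
    (∃ c : Fin n, k.val = c.val ∧ boundaryEdge k = .inr (0, c)) ∨
    (∃ r : Fin n, k.val = n + r.val ∧ boundaryEdge k = .inl (r, Fin.last n)) ∨
    (∃ c : Fin n, k.val = 3 * n - 1 - c.val ∧ boundaryEdge k = .inr (Fin.last n, c)) ∨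
    (∃ r : Fin n, k.val = 4 * n - 1 - r.val ∧ boundaryEdge k = .inl (r, 0)) := by
  have hk := k.isLt
  by_cases h1 : k.val < n
  · exact .inl ⟨⟨k, h1⟩, rfl, boundaryEdge_bottom ⟨k, h1⟩⟩
  by_cases h2 : k.val < 2 * n
  · refine .inr (.inl ⟨⟨k - n, by omega⟩, by simp only; omega, ?_⟩)
    rw [← boundaryEdge_right]
    congr 1
    ext
    simp only
    omega
  by_cases h3 : k.val < 3 * n
  · refine .inr (.inr (.inl ⟨⟨3 * n - 1 - k, by omega⟩, by simp only; omega, ?_⟩))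
    rw [← boundaryEdge_top]
    congr 1
    ext
    simp only
    omega
  · refine .inr (.inr (.inr ⟨⟨4 * n - 1 - k, by omega⟩, by simp only; omega, ?_⟩))
    rw [← boundaryEdge_left]
    congr 1
    ext
    simp only
    omega

theorem not_alt_boundaryEdge {n : ℕ} (φ : Edge n → Colour) (ε : ℕ) (k : Fin (4 * n)) :
    ¬ Alt φ (cell ε (boundaryEdge k)) := by
  rintro ⟨r, c, hr, hc, h, -⟩
  rcases boundaryEdge_cases k with ⟨x, -, hx⟩ | ⟨x, -, hx⟩ | ⟨x, -, hx⟩ | ⟨x, -, hx⟩ <;>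
    rw [hx] at h <;> simp only [cell] at h <;> split_ifs at h <;> simp at h <;> omega

theorem boundaryEdge_injective {n : ℕ} :
    Function.Injective (boundaryEdge : Fin (4 * n) → Edge n) := by
  intro k l h
  ext
  rcases boundaryEdge_cases k with ⟨x, hx, hx'⟩ | ⟨x, hx, hx'⟩ | ⟨x, hx, hx'⟩ | ⟨x, hx, hx'⟩ <;>
  rcases boundaryEdge_cases l with ⟨y, hy, hy'⟩ | ⟨y, hy, hy'⟩ | ⟨y, hy, hy'⟩ | ⟨y, hy, hy'⟩ <;>
  rw [hx', hy'] at h <;> simp [Fin.ext_iff] at h <;> omega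

theorem gyrate_mem {n s s' : ℕ} {φ : Edge n → Colour} (hφ : φ ∈ FplAt n s) (ε : ℕ)
    (hs : s % 2 ≠ s' % 2) : gyrate ε φ ∈ FplAt n s' := by
  refine ⟨hφ.1.gyrate ε, fun k => ?_⟩
  have h := hφ.2 k
  rw [gyrate_of_not_alt (not_alt_boundaryEdge φ ε k), Colour.flip_eq_iff, Ne, h]
  omega

theorem swapCell_mem {n s : ℕ} {φ : Edge n → Colour} (hφ : φ ∈ FplAt n s) (P : ℕ × ℕ) :
    swapCell P φ ∈ FplAt n s := by
  refine ⟨hφ.1.swapCell P, fun k => ?_⟩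
  by_cases h : Alt φ P
  · rw [swapCell_of_cell_ne fun h' => ?_, hφ.2]
    exact not_alt_boundaryEdge φ (P.1 + P.2) k (h'.symm ▸ h)
  · rw [swapCell_of_not_alt h, hφ.2]

/-! ### Black connections inside one cell. -/

theorem BlackConnected.of_star {n : ℕ} {φ : Edge n → Colour} {e f : Edge n} (v : Vertex n)
    (he : φ e = .b) (hf : φ f = .b) (hv : e ∈ star v) (hv' : f ∈ star v) :
    BlackConnected φ e f :=
  .single ⟨he, hf, v, hv, hv'⟩

theorem BlackConnected.symm {n : ℕ} {φ : Edge n → Colour} {e f : Edge n}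
    (h : BlackConnected φ e f) : BlackConnected φ f e := by
  induction h with
  | refl => exact .refl
  | tail _ h ih =>
    obtain ⟨h1, h2, v, h3, h4⟩ := h
    exact .head ⟨h2, h1, v, h4, h3⟩ ih

/-- The edges of a cell: the bottom, top, left and right one. -/
theorem cell_cases {n : ℕ} {ε : ℕ} {e : Edge n} {r c : ℕ} (h : cell ε e = (r, c)) :
    (∃ (_ : 1 ≤ r) (h₁ : r - 1 < n) (h₂ : c < n + 1), e = .inl (⟨r - 1, h₁⟩, ⟨c, h₂⟩)) ∨
    (∃ (h₁ : r < n) (h₂ : c < n + 1), e = .inl (⟨r, h₁⟩, ⟨c, h₂⟩)) ∨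
    (∃ (_ : 1 ≤ c) (h₁ : r < n + 1) (h₂ : c - 1 < n), e = .inr (⟨r, h₁⟩, ⟨c - 1, h₂⟩)) ∨
    (∃ (h₁ : r < n + 1) (h₂ : c < n), e = .inr (⟨r, h₁⟩, ⟨c, h₂⟩)) := by
  rcases e with ⟨⟨x, hx⟩, ⟨y, hy⟩⟩ | ⟨⟨x, hx⟩, ⟨y, hy⟩⟩ <;> simp only [cell] at h <;>
    split_ifs at h <;> simp only [Prod.mk.injEq] at h <;> obtain ⟨rfl, rfl⟩ := h <;> simp <;> omega

/-- Perpendicular edges of a cell share a corner. Two opposite black edges of an inner cell are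
joined through a third black edge, for otherwise the cell would alternate. In a border cell two
opposite edges are consecutive boundary edges and cannot both be black. -/
theorem blackConnected_of_cell_eq {n s ε : ℕ} {φ : Edge n → Colour} (hφ : φ ∈ FplAt n s)
    {e f : Edge n} (he : φ e = .b) (hf : φ f = .b) (h : cell ε e = cell ε f)
    (ha : ¬ Alt φ (cell ε e)) : BlackConnected φ e f := by
  obtain ⟨r, c, hP⟩ : ∃ r c, cell ε e = (r, c) := ⟨_, _, rfl⟩
  have bl : ∀ (h1 : 1 ≤ r) (h2 : r - 1 < n) (h3 : c < n + 1) (h4 : 1 ≤ c) (h5 : r < n + 1)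
      (h6 : c - 1 < n), φ (.inl (⟨r - 1, h2⟩, ⟨c, h3⟩)) = .b →
      φ (.inr (⟨r, h5⟩, ⟨c - 1, h6⟩)) = .b →
      BlackConnected φ (.inl (⟨r - 1, h2⟩, ⟨c, h3⟩)) (.inr (⟨r, h5⟩, ⟨c - 1, h6⟩)) := by
    intro h1 h2 h3 h4 h5 h6 h7 h8
    refine .of_star (⟨r - 1, h2⟩, ⟨c - 1, h6⟩) h7 h8 ?_ ?_ <;>
      simp [mem_star, leftEdge, rightEdge, topEdge, bottomEdge, Fin.ext_iff] <;> omega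
  have br : ∀ (h1 : 1 ≤ r) (h2 : r - 1 < n) (h3 : c < n + 1) (h5 : r < n + 1)
      (h6 : c < n), φ (.inl (⟨r - 1, h2⟩, ⟨c, h3⟩)) = .b →
      φ (.inr (⟨r, h5⟩, ⟨c, h6⟩)) = .b →
      BlackConnected φ (.inl (⟨r - 1, h2⟩, ⟨c, h3⟩)) (.inr (⟨r, h5⟩, ⟨c, h6⟩)) := by
    intro h1 h2 h3 h5 h6 h7 h8
    refine .of_star (⟨r - 1, h2⟩, ⟨c, h6⟩) h7 h8 ?_ ?_ <;>
      simp [mem_star, leftEdge, rightEdge, topEdge, bottomEdge, Fin.ext_iff] <;> omega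
  have tl : ∀ (h2 : r < n) (h3 : c < n + 1) (h4 : 1 ≤ c) (h5 : r < n + 1)
      (h6 : c - 1 < n), φ (.inl (⟨r, h2⟩, ⟨c, h3⟩)) = .b →
      φ (.inr (⟨r, h5⟩, ⟨c - 1, h6⟩)) = .b →
      BlackConnected φ (.inl (⟨r, h2⟩, ⟨c, h3⟩)) (.inr (⟨r, h5⟩, ⟨c - 1, h6⟩)) := by
    intro h2 h3 h4 h5 h6 h7 h8
    refine .of_star (⟨r, h2⟩, ⟨c - 1, h6⟩) h7 h8 ?_ ?_ <;>
      simp [mem_star, leftEdge, rightEdge, topEdge, bottomEdge, Fin.ext_iff] <;> omega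
  have tr : ∀ (h2 : r < n) (h3 : c < n + 1) (h5 : r < n + 1)
      (h6 : c < n), φ (.inl (⟨r, h2⟩, ⟨c, h3⟩)) = .b →
      φ (.inr (⟨r, h5⟩, ⟨c, h6⟩)) = .b →
      BlackConnected φ (.inl (⟨r, h2⟩, ⟨c, h3⟩)) (.inr (⟨r, h5⟩, ⟨c, h6⟩)) := by
    intro h2 h3 h5 h6 h7 h8
    refine .of_star (⟨r, h2⟩, ⟨c, h6⟩) h7 h8 ?_ ?_ <;>
      simp [mem_star, leftEdge, rightEdge, topEdge, bottomEdge, Fin.ext_iff]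
  have bt : ∀ (h1 : 1 ≤ r) (h2 : r - 1 < n) (h3 : c < n + 1) (h4 : r < n),
      φ (.inl (⟨r - 1, h2⟩, ⟨c, h3⟩)) = .b → φ (.inl (⟨r, h4⟩, ⟨c, h3⟩)) = .b →
      BlackConnected φ (.inl (⟨r - 1, h2⟩, ⟨c, h3⟩)) (.inl (⟨r, h4⟩, ⟨c, h3⟩)) := by
    intro h1 h2 h3 h4 h5 h6
    rcases Nat.eq_zero_or_pos c with rfl | hc
    · have h7 := hφ.2 ⟨4 * n - 1 - (r - 1), by omega⟩
      have h8 := hφ.2 ⟨4 * n - 1 - r, by omega⟩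
      rw [boundaryEdge_left ⟨r - 1, h2⟩] at h7
      rw [boundaryEdge_left ⟨r, h4⟩] at h8
      have h9 := h7.1 h5
      have h10 := h8.1 h6
      simp only at h9 h10
      omega
    rcases Nat.lt_or_ge c n with hc' | hc'
    · obtain ⟨r, rfl⟩ : ∃ r', r = r' + 1 := ⟨r - 1, by omega⟩
      obtain ⟨c, rfl⟩ : ∃ c', c = c' + 1 := ⟨c - 1, by omega⟩
      by_cases hl : φ (.inr (⟨r + 1, by omega⟩, ⟨c, by omega⟩)) = .b
      · exact (bl (by omega) _ _ (by omega) _ _ h5 hl).trans (tl _ _ (by omega) _ _ h6 hl).symm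
      by_cases hr : φ (.inr (⟨r + 1, by omega⟩, ⟨c + 1, by omega⟩)) = .b
      · exact (br (by omega) _ _ _ _ h5 hr).trans (tr _ _ _ _ h6 hr).symm
      · replace hl := Colour.ne_b.1 hl
        replace hr := Colour.ne_b.1 hr
        refine absurd ⟨r, c, h4, hc', hP, ?_⟩ ha
        simp only [Nat.add_sub_cancel] at h5
        simp [hl, hr, h5, h6]
    · obtain rfl : c = n := by omega
      have h7 := hφ.2 ⟨c + (r - 1), by omega⟩
      have h8 := hφ.2 ⟨c + r, by omega⟩
      rw [boundaryEdge_right ⟨r - 1, h2⟩] at h7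
      rw [boundaryEdge_right ⟨r, h4⟩] at h8
      have h9 := h7.1 h5
      have h10 := h8.1 h6
      simp only at h9 h10
      omega
  have lr : ∀ (h1 : 1 ≤ c) (h2 : c - 1 < n) (h3 : r < n + 1) (h4 : c < n),
      φ (.inr (⟨r, h3⟩, ⟨c - 1, h2⟩)) = .b → φ (.inr (⟨r, h3⟩, ⟨c, h4⟩)) = .b →
      BlackConnected φ (.inr (⟨r, h3⟩, ⟨c - 1, h2⟩)) (.inr (⟨r, h3⟩, ⟨c, h4⟩)) := by
    intro h1 h2 h3 h4 h5 h6
    rcases Nat.eq_zero_or_pos r with rfl | hr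
    · have h7 := hφ.2 ⟨c - 1, by omega⟩
      have h8 := hφ.2 ⟨c, by omega⟩
      rw [boundaryEdge_bottom ⟨c - 1, h2⟩] at h7
      rw [boundaryEdge_bottom ⟨c, h4⟩] at h8
      have h9 := h7.1 h5
      have h10 := h8.1 h6
      simp only at h9 h10
      omega
    rcases Nat.lt_or_ge r n with hr' | hr'
    · obtain ⟨r, rfl⟩ : ∃ r', r = r' + 1 := ⟨r - 1, by omega⟩
      obtain ⟨c, rfl⟩ : ∃ c', c = c' + 1 := ⟨c - 1, by omega⟩
      by_cases hb : φ (.inl (⟨r, by omega⟩, ⟨c + 1, by omega⟩)) = .b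
      · exact (bl (by omega) _ _ (by omega) _ _ hb h5).symm.trans (br (by omega) _ _ _ _ hb h6)
      by_cases ht : φ (.inl (⟨r + 1, by omega⟩, ⟨c + 1, by omega⟩)) = .b
      · exact (tl _ _ (by omega) _ _ ht h5).symm.trans (tr _ _ _ _ ht h6)
      · replace hb := Colour.ne_b.1 hb
        replace ht := Colour.ne_b.1 ht
        refine absurd ⟨r, c, hr', h4, hP, ?_⟩ ha
        simp only [Nat.add_sub_cancel] at h5
        simp [hb, ht, h5, h6]
    · obtain rfl : r = n := by omega
      have h7 := hφ.2 ⟨3 * r - 1 - (c - 1), by omega⟩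
      have h8 := hφ.2 ⟨3 * r - 1 - c, by omega⟩
      rw [boundaryEdge_top ⟨c - 1, h2⟩] at h7
      rw [boundaryEdge_top ⟨c, h4⟩] at h8
      have h9 := h7.1 h5
      have h10 := h8.1 h6
      simp only at h9 h10
      omega
  rcases cell_cases hP with
    ⟨a1, a2, a3, rfl⟩ | ⟨a2, a3, rfl⟩ | ⟨a1, a2, a3, rfl⟩ | ⟨a2, a3, rfl⟩ <;>
  rcases cell_cases (h ▸ hP) with
    ⟨b1, b2, b3, rfl⟩ | ⟨b2, b3, rfl⟩ | ⟨b1, b2, b3, rfl⟩ | ⟨b2, b3, rfl⟩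
  · exact .refl
  · exact bt a1 _ _ _ he hf
  · exact bl a1 _ _ b1 _ _ he hf
  · exact br a1 _ _ _ _ he hf
  · exact (bt b1 _ _ _ hf he).symm
  · exact .refl
  · exact tl _ _ b1 _ _ he hf
  · exact tr _ _ _ _ he hf
  · exact (bl b1 _ _ a1 _ _ hf he).symm
  · exact (tl _ _ a1 _ _ hf he).symm
  · exact .refl
  · exact lr a1 _ _ _ he hf
  · exact (br b1 _ _ _ _ hf he).symm
  · exact (tr _ _ _ _ hf he).symm
  · exact (lr b1 _ _ _ hf he).symm
  · exact .refl

theorem IsQuad.swap {n : ℕ} {ε : ℕ} {v : Vertex n} {p q p' q' : Edge n}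
    (h : IsQuad ε v p q p' q') : IsQuad ε v q p p' q' where
  mem e := by rw [h.mem]; tauto
  cell_eq := h.cell_eq.symm
  cell_eq' := h.cell_eq'
  ne := h.ne.symm
  ne' := h.ne'
  ice φ := by
    rw [h.ice]
    clear h
    cases φ p <;> cases φ q <;> cases φ p' <;> cases φ q' <;> simp

theorem exists_isQuad_of_mem {n : ℕ} (ε : ℕ) {v : Vertex n} {e : Edge n} (h : e ∈ star v) :
    ∃ q p' q', IsQuad ε v e q p' q' := by
  obtain ⟨p, q, p', q', hq⟩ := exists_isQuad ε v
  rcases (hq.mem e).1 h with rfl | rfl | rfl | rfl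
  exacts [⟨_, _, _, hq⟩, ⟨_, _, _, hq.swap⟩, ⟨_, _, _, hq.symm⟩, ⟨_, _, _, hq.symm.swap⟩]

/-! ## Half gyration preserves the black connections -/

theorem blackConnected_gyrate {n s s' ε : ℕ} {φ : Edge n → Colour} (hφ : φ ∈ FplAt n s)
    (hs : s % 2 ≠ s' % 2) {e f e' f' : Edge n} (h : BlackConnected φ e f)
    (he' : gyrate ε φ e' = .b) (hf' : gyrate ε φ f' = .b)
    (he : cell ε e' = cell ε e) (hf : cell ε f' = cell ε f)
    (hae : ¬ Alt φ (cell ε e)) (haf : ¬ Alt φ (cell ε f)) :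
    BlackConnected (gyrate ε φ) e' f' := by
  have hψ := gyrate_mem hφ ε hs
  -- The invariant carried along the old path: if the cell of the current edge is not alternating,
  -- the new path from `e'` reaches every new black edge of this cell; if it is alternating, it
  -- reaches the current edge itself, whose colour is kept.
  suffices key : ∀ f, BlackConnected φ e f →
      (¬ Alt φ (cell ε f) → ∀ g, cell ε g = cell ε f → gyrate ε φ g = .b →
        BlackConnected (gyrate ε φ) e' g) ∧
      (Alt φ (cell ε f) → BlackConnected (gyrate ε φ) e' f) from
    (key f h).1 haf f' hf hf'
  have conn : ∀ a b, gyrate ε φ a = .b → gyrate ε φ b = .b → cell ε a = cell ε b →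
      ¬ Alt φ (cell ε a) → BlackConnected (gyrate ε φ) a b := fun a b ha hb hab h =>
    blackConnected_of_cell_eq hψ ha hb hab (by rwa [alt_gyrate (cell_parity ε a)])
  intro f h
  induction h with
  | refl => exact ⟨fun _ g hg hg' => conn _ _ he' hg' (he.trans hg.symm) (he ▸ hae),
      fun h => absurd h hae⟩
  | @tail f g _ hfg ih =>
    obtain ⟨hf, hg, v, hv, hv'⟩ := hfg
    obtain ⟨ih1, ih2⟩ := ih
    by_cases hfg : f = g
    · subst hfg
      exact ⟨ih1, ih2⟩
    obtain ⟨q, p', q', hq⟩ := exists_isQuad_of_mem ε hv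
    have hice := (hq.ice φ).1 (iceRule_iff.1 hφ.1 v)
    have hgm := (hq.mem g).1 hv'
    have hpv := (hq.mem f).2 (.inl rfl)
    have hqv := (hq.mem q).2 (.inr (.inl rfl))
    have hpv' := (hq.mem p').2 (.inr (.inr (.inl rfl)))
    have hqv' := (hq.mem q').2 (.inr (.inr (.inr rfl)))
    by_cases hgq : g = q
    · subst hgq
      -- The old path turns within one cell, so the invariant is literally unchanged. From here on
      -- it passes to the other cell at `v`; then both pairs at `v` have two colours, and each still
      -- contains a black edge after the half gyration.
      have hna : ¬ Alt φ (cell ε f) := fun h => h.ne hq (hf.trans hg.symm)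
      rw [← hq.cell_eq]
      exact ⟨ih1, fun h => absurd h hna⟩
    have hgm' : g = p' ∨ g = q' := by
      rcases hgm with h | h | h
      exacts [absurd h.symm hfg, absurd h hgq, h]
    have hne : φ f ≠ φ q := by
      rcases hice with ⟨h1, -⟩ | ⟨-, h2, h3⟩
      · exact h1
      · rcases hgm' with rfl | rfl
        exacts [absurd (hf.trans hg.symm) h3, absurd (hf.trans (hg.symm.trans h2.symm)) h3]
    have hne' : φ p' ≠ φ q' := (hice.resolve_right fun h => hne h.1).2
    have hcg : cell ε g = cell ε p' := by
      rcases hgm' with rfl | rfl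
      exacts [rfl, hq.cell_eq'.symm]
    -- the black edge of the new colouring at `v` in the cell of `f`
    obtain ⟨a, hav, hac, hab, hconn⟩ : ∃ a, a ∈ star v ∧ cell ε a = cell ε f ∧
        gyrate ε φ a = .b ∧ BlackConnected (gyrate ε φ) e' a := by
      by_cases hA : Alt φ (cell ε f)
      · exact ⟨f, hpv, rfl, by rw [gyrate_of_alt hA, hf], ih2 hA⟩
      · have h1 : gyrate ε φ q = .b := by
          rw [gyrate_of_not_alt (hq.cell_eq ▸ hA), Colour.flip_eq_iff, ← hf]
          exact hne.symm
        exact ⟨q, hqv, hq.cell_eq.symm, h1, ih1 hA q hq.cell_eq.symm h1⟩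
    by_cases hB : Alt φ (cell ε g)
    · refine ⟨fun h => absurd hB h, fun _ => hconn.trans ?_⟩
      exact BlackConnected.of_star v hab (by rw [gyrate_of_alt hB, hg]) hav hv'
    · refine ⟨fun _ k hk hk' => ?_, fun h => absurd h hB⟩
      obtain ⟨b, hbv, hbc, hbb⟩ : ∃ b, b ∈ star v ∧ cell ε b = cell ε g ∧ gyrate ε φ b = .b := by
        rcases hgm' with rfl | rfl
        · refine ⟨q', hqv', hq.cell_eq'.symm, ?_⟩
          rw [gyrate_of_not_alt (hq.cell_eq' ▸ hB), Colour.flip_eq_iff, ← hg]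
          exact hne'.symm
        · refine ⟨p', hpv', hq.cell_eq', ?_⟩
          rw [gyrate_of_not_alt (hq.cell_eq' ▸ hB), Colour.flip_eq_iff, ← hg]
          exact hne'
      exact (hconn.trans (BlackConnected.of_star v hab hbb hav hbv)).trans
        (conn _ _ hbb hk' (hbc.trans hk.symm) (hbc ▸ hB))

/-! ### Border cells shared by consecutive boundary edges. -/

theorem cell_inl {n : ℕ} (ε : ℕ) (r : Fin n) (k : Fin (n + 1)) :
    cell ε (.inl (r, k)) = (r.val + (r.val + k.val + ε) % 2, k.val) := by
  simp only [cell]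
  split_ifs <;> simp only [Prod.mk.injEq, and_true] <;> omega

theorem cell_inr {n : ℕ} (ε : ℕ) (k : Fin (n + 1)) (c : Fin n) :
    cell ε (.inr (k, c)) = (k.val, c.val + (k.val + c.val + ε) % 2) := by
  simp only [cell]
  split_ifs <;> simp only [Prod.mk.injEq, true_and] <;> omega

theorem cell_boundaryEdge_succ {n ε k : ℕ} (hk : k + 1 < 4 * n) (hε : ε % 2 = (k + 1) % 2) :
    cell ε (boundaryEdge ⟨k, by omega⟩ : Edge n) = cell ε (boundaryEdge ⟨k + 1, hk⟩) := by
  rcases boundaryEdge_cases (⟨k, by omega⟩ : Fin (4 * n)) with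
    ⟨x, hx, hx'⟩ | ⟨x, hx, hx'⟩ | ⟨x, hx, hx'⟩ | ⟨x, hx, hx'⟩ <;>
  rcases boundaryEdge_cases (⟨k + 1, hk⟩ : Fin (4 * n)) with
    ⟨y, hy, hy'⟩ | ⟨y, hy, hy'⟩ | ⟨y, hy, hy'⟩ | ⟨y, hy, hy'⟩ <;>
  rw [hx', hy'] <;> simp only at hx hy <;> first
    | (exfalso; omega)
    | (simp only [cell_inl, cell_inr, Fin.val_last, Fin.val_zero, Prod.mk.injEq, true_and,
        and_true]
       omega)

/-! ## Link patterns for both boundary conditions -/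

/-- The black endpoint with label `x`, if the boundary edges of the parity of `s` are black. -/
def endAt {n : ℕ} [NeZero n] (s : Fin 2) (x : ZMod (2 * n)) : Edge n :=
  boundaryEdge ⟨2 * (x - 1).val + s, by have := ZMod.val_lt (x - 1); omega⟩

/-- The link pattern of a colouring in `FplAt n s`. -/
def LinkedBy {n : ℕ} [NeZero n] (s : Fin 2) (φ : Edge n → Colour) (π : LinkPattern n) : Prop :=
  ∀ x y : ZMod (2 * n), π.partner x = y ↔ x ≠ y ∧ BlackConnected φ (endAt s x) (endAt s y)

variable {n : ℕ} [NeZero n]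

theorem LinkedBy.unique {s : Fin 2} {φ : Edge n → Colour} {π π' : LinkPattern n}
    (h : LinkedBy s φ π) (h' : LinkedBy s φ π') : π = π' := by
  ext x
  rw [(h' x _).2 ((h x _).1 rfl)]

theorem endAt_black {s : Fin 2} {φ : Edge n → Colour} (hφ : φ ∈ FplAt n s) (x : ZMod (2 * n)) :
    φ (endAt s x) = .b :=
  (hφ.2 _).2 (by simp only; omega)

theorem cell_boundaryEdge_zero {ε : ℕ} (hε : ε % 2 = 0) :
    cell ε (boundaryEdge (n := n) ⟨4 * n - 1, by have := NeZero.pos n; omega⟩) =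
      cell ε (boundaryEdge (n := n) ⟨0, by have := NeZero.pos n; omega⟩) := by
  have h1 := boundaryEdge_left (⟨0, NeZero.pos n⟩ : Fin n)
  have h2 := boundaryEdge_bottom (⟨0, NeZero.pos n⟩ : Fin n)
  simp only [Nat.sub_zero] at h1 h2
  rw [h1, h2]
  simp [cell, hε]

theorem cell_endAt_one (x : ZMod (2 * n)) : cell 1 (endAt 1 x) = cell 1 (endAt 0 x) :=
  (cell_boundaryEdge_succ (k := 2 * (x - 1).val) (by have := ZMod.val_lt (x - 1); omega)
    (by omega)).symm

/-- This shift of the label is the source of the rotation. For the label 1 the pair consists of the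
last and the first boundary edge, which share the bottom-left corner cell. -/
theorem cell_endAt_zero (x : ZMod (2 * n)) : cell 0 (endAt 1 (x - 1)) = cell 0 (endAt 0 x) := by
  have h := val_add_one_cases (x - 1 - 1)
  rw [sub_add_cancel] at h
  unfold endAt
  rcases h with ⟨h1, h2⟩ | ⟨h1, h2⟩
  · simp only [h2]
    exact cell_boundaryEdge_succ (k := 2 * (x - 1 - 1).val + 1) (by omega) (by omega)
  · simp only [h2]
    refine Eq.trans (congrArg (fun k => cell 0 (boundaryEdge k)) (Fin.ext ?_))
      (cell_boundaryEdge_zero (n := n) (ε := 0) rfl)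
    simp only [Fin.val_one]
    omega

theorem LinkedBy.of_cells {ε : ℕ} {s s' : Fin 2} {φ : Edge n → Colour} {π : LinkPattern n}
    (hφ : φ ∈ FplAt n s) (hs : s ≠ s') (h : LinkedBy s φ π) (f : ZMod (2 * n) ≃ ZMod (2 * n))
    (hf : ∀ x, cell ε (endAt s' (f x)) = cell ε (endAt s x)) {π' : LinkPattern n}
    (hπ' : ∀ x, π'.partner (f x) = f (π.partner x)) : LinkedBy s' (gyrate ε φ) π' := by
  have hs1 : s.val % 2 ≠ s'.val % 2 := by omega
  have hψ := gyrate_mem hφ ε hs1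
  have key : ∀ x y, BlackConnected (gyrate ε φ) (endAt s' (f x)) (endAt s' (f y)) ↔
      BlackConnected φ (endAt s x) (endAt s y) := by
    intro x y
    constructor
    · intro hc
      -- Half gyration is an involution, so applying the same lemma to the gyrated colouring gives
      -- the converse.
      have := blackConnected_gyrate (ε := ε) hψ hs1.symm hc (e' := endAt s x) (f' := endAt s y)
      rw [gyrate_gyrate] at this
      exact this (endAt_black hφ x) (endAt_black hφ y) (hf x).symm (hf y).symm
        (not_alt_boundaryEdge _ _ _) (not_alt_boundaryEdge _ _ _)
    · intro hc
      exact blackConnected_gyrate hφ hs1 hc (endAt_black hψ _) (endAt_black hψ _) (hf x) (hf y)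
        (not_alt_boundaryEdge _ _ _) (not_alt_boundaryEdge _ _ _)
  intro x y
  obtain ⟨x, rfl⟩ := f.surjective x
  obtain ⟨y, rfl⟩ := f.surjective y
  rw [key, hπ', f.apply_eq_iff_eq, h x y, f.injective.ne_iff]

theorem LinkedBy.gyrate_one {s s' : Fin 2} {φ : Edge n → Colour} {π : LinkPattern n}
    (hφ : φ ∈ FplAt n s) (hs : s ≠ s') (h : LinkedBy s φ π) : LinkedBy s' (gyrate 1 φ) π := by
  refine h.of_cells hφ hs (Equiv.refl _) (fun x => ?_) fun x => rfl
  fin_cases s <;> fin_cases s'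
  · exact absurd rfl hs
  · exact cell_endAt_one x
  · exact (cell_endAt_one x).symm
  · exact absurd rfl hs

theorem LinkedBy.gyrate_zero {φ : Edge n → Colour} {π : LinkPattern n}
    (hφ : φ ∈ FplAt n 0) (h : LinkedBy 0 φ π) : LinkedBy 1 (gyrate 0 φ) (R π) :=
  h.of_cells hφ (by decide) (Equiv.subRight 1) (fun x => cell_endAt_zero x)
    fun x => by simp [R, rotate]

theorem LinkedBy.gyrate_zero' {φ : Edge n → Colour} {π : LinkPattern n}
    (hφ : φ ∈ FplAt n 1) (h : LinkedBy 1 φ π) : LinkedBy 0 (gyrate 0 φ) (R.symm π) :=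
  h.of_cells hφ (by decide) (Equiv.addRight 1)
    (fun x => by
      have := cell_endAt_zero (x + 1)
      rw [add_sub_cancel_right] at this
      exact this.symm)
    fun x => by simp [R, unrotate]

/-! ## The potential of a set of edges that meets each vertex evenly -/

section Potential

variable {n : ℕ} (χ : Edge n → ZMod 2)

/-- The value of `χ` at the horizontal edge `(r, k)`. -/
def horVal (r k : ℕ) : ZMod 2 :=
  if h : r < n ∧ k < n + 1 then χ (.inl (⟨r, h.1⟩, ⟨k, h.2⟩)) else 0

/-- The value of `χ` at the vertical edge `(k, c)`. -/
def verVal (k c : ℕ) : ZMod 2 :=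
  if h : k < n + 1 ∧ c < n then χ (.inr (⟨k, h.1⟩, ⟨c, h.2⟩)) else 0

/-- The parity of the number of edges of `χ` between the cells `(0, 0)` and `(r, c)`. -/
def potential (r c : ℕ) : ZMod 2 :=
  ∑ i ∈ Finset.range c, verVal χ r i + ∑ i ∈ Finset.range r, horVal χ i 0

/-- The edges in the support of `χ` meet each vertex evenly. -/
def EvenAt : Prop :=
  ∀ v : Vertex n, χ (leftEdge v) + χ (rightEdge v) + χ (bottomEdge v) + χ (topEdge v) = 0

variable {χ}

theorem horVal_eq (r : Fin n) (k : Fin (n + 1)) : horVal χ r k = χ (.inl (r, k)) := by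
  rw [horVal, dif_pos ⟨r.isLt, k.isLt⟩]

theorem verVal_eq (k : Fin (n + 1)) (c : Fin n) : verVal χ k c = χ (.inr (k, c)) := by
  rw [verVal, dif_pos ⟨k.isLt, c.isLt⟩]

theorem potential_right (r c : ℕ) : potential χ r (c + 1) = potential χ r c + verVal χ r c := by
  simp only [potential, Finset.sum_range_succ]
  ring

/-- Path independence of the potential: evenness at a vertex makes the increments around its four
cells cancel, and induction on the column transports this along the row. -/
theorem potential_up (hχ : EvenAt χ) {r c : ℕ} (hr : r < n) (hc : c ≤ n) :
    potential χ (r + 1) c = potential χ r c + horVal χ r c := by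
  induction c with
  | zero => simp [potential, Finset.sum_range_succ]
  | succ c ih =>
    have h1 := hχ (⟨r, hr⟩, ⟨c, hc⟩)
    have h2 : horVal χ r c + horVal χ r (c + 1) + verVal χ r c + verVal χ (r + 1) c = 0 := by
      rw [← h1]
      congr 1
      · congr 1
        · congr 1
          · exact horVal_eq ⟨r, hr⟩ ⟨c, by omega⟩
          · exact horVal_eq ⟨r, hr⟩ ⟨c + 1, by omega⟩
        · exact verVal_eq ⟨r, by omega⟩ ⟨c, hc⟩
      · exact verVal_eq ⟨r + 1, by omega⟩ ⟨c, hc⟩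
    have h3 : (2 : ZMod 2) = 0 := rfl
    rw [potential_right, potential_right, ih (by omega)]
    linear_combination h2 - (verVal χ r c + horVal χ r (c + 1)) * h3

/-- The cell before the `k`-th boundary edge. -/
def boundaryCell (n k : ℕ) : ℕ × ℕ :=
  if k ≤ n then (0, k) else if k ≤ 2 * n then (k - n, n) else if k ≤ 3 * n then (n, 3 * n - k)
  else (4 * n - k, 0)

theorem boundaryCell_bottom {k c : ℕ} (h : k = c) (hc : c ≤ n) : boundaryCell n k = (0, c) := by
  simp [boundaryCell, h, hc]

theorem boundaryCell_right {k r : ℕ} (h : k = n + r) (hr : r ≤ n) :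
    boundaryCell n k = (r, n) := by
  unfold boundaryCell
  split_ifs <;> rw [Prod.mk.injEq] <;> omega

theorem boundaryCell_top {k c : ℕ} (h : k + c = 3 * n) (hc : c ≤ n) :
    boundaryCell n k = (n, c) := by
  unfold boundaryCell
  split_ifs <;> rw [Prod.mk.injEq] <;> omega

theorem boundaryCell_left {k r : ℕ} (h : k + r = 4 * n) (hr : r ≤ n) :
    boundaryCell n k = (r, 0) := by
  unfold boundaryCell
  split_ifs <;> rw [Prod.mk.injEq] <;> omega

/-- The potential of the cell before the `k`-th boundary edge. -/
def boundaryPotential (χ : Edge n → ZMod 2) (k : ℕ) : ZMod 2 :=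
  potential χ (boundaryCell n k).1 (boundaryCell n k).2

/-- The potential of one of the two cells of an edge. -/
def edgePotential (χ : Edge n → ZMod 2) : Edge n → ZMod 2
  | .inl (r, k) => potential χ r k
  | .inr (k, c) => potential χ k c

/-- Along the top and left sides the walk runs against the direction of summation, which is harmless
modulo 2. When `χ` vanishes on an edge, both of its cells have the same potential, so the choice
made in `edgePotential` does not matter. -/
theorem boundaryPotential_succ (hχ : EvenAt χ) (k : Fin (4 * n)) :
    boundaryPotential χ (k + 1) = boundaryPotential χ k + χ (boundaryEdge k) ∧
    (χ (boundaryEdge k) = 0 → edgePotential χ (boundaryEdge k) = boundaryPotential χ k) := by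
  have h3 : (2 : ZMod 2) = 0 := rfl
  have hk := k.isLt
  unfold boundaryPotential
  rcases boundaryEdge_cases k with ⟨x, hx, hx'⟩ | ⟨x, hx, hx'⟩ | ⟨x, hx, hx'⟩ | ⟨x, hx, hx'⟩
  · rw [hx', boundaryCell_bottom hx (by omega),
      boundaryCell_bottom (c := x + 1) (by omega) (by omega), ← verVal_eq (χ := χ)]
    exact ⟨potential_right 0 x, fun _ => rfl⟩
  · rw [hx', boundaryCell_right hx (by omega),
      boundaryCell_right (r := x + 1) (by omega) (by omega), ← horVal_eq (χ := χ)]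
    exact ⟨potential_up hχ x.isLt le_rfl, fun _ => rfl⟩
  · rw [hx', boundaryCell_top (k := k) (c := x + 1) (by omega) (by omega),
      boundaryCell_top (k := k + 1) (c := x) (by omega) (by omega), ← verVal_eq (χ := χ)]
    simp only [potential_right, edgePotential, Fin.val_last]
    refine ⟨?_, fun h => by rw [h, add_zero]⟩
    linear_combination - verVal χ n x * h3
  · rw [hx', boundaryCell_left (k := k) (r := x + 1) (by omega) (by omega),
      boundaryCell_left (k := k + 1) (r := x) (by omega) (by omega), ← horVal_eq (χ := χ)]
    simp only [potential_up hχ x.isLt (Nat.zero_le n), edgePotential, Fin.val_zero]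
    refine ⟨?_, fun h => by rw [h, add_zero]⟩
    linear_combination - horVal χ x 0 * h3

theorem boundaryPotential_eq_sum (hχ : EvenAt χ) {m : ℕ} (hm : m ≤ 4 * n) :
    boundaryPotential χ m =
      ∑ i ∈ Finset.range m, if h : i < 4 * n then χ (boundaryEdge ⟨i, h⟩) else 0 := by
  induction m with
  | zero => simp [boundaryPotential, boundaryCell, potential]
  | succ m ih =>
    rw [Finset.sum_range_succ, ← ih (by omega), (boundaryPotential_succ hχ ⟨m, hm⟩).1,
      dif_pos (by omega)]

/-- The walk around the border returns to the cell `(0, 0)`, where the potential is zero. -/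
theorem sum_boundaryEdge_eq_zero (hχ : EvenAt χ) : ∑ k, χ (boundaryEdge k) = 0 := by
  have h := boundaryPotential_eq_sum hχ le_rfl
  rw [boundaryPotential, boundaryCell_left (r := 0) (by omega) (by omega), Finset.sum_range] at h
  simpa [potential] using h.symm

theorem edgePotential_eq_of_star (hχ : EvenAt χ) {v : Vertex n} (hv : ∀ e ∈ star v, χ e = 0)
    {e f : Edge n} (he : e ∈ star v) (hf : f ∈ star v) :
    edgePotential χ e = edgePotential χ f := by
  have hl : horVal χ v.1 v.2 = 0 :=
    (horVal_eq v.1 v.2.castSucc).trans (hv (leftEdge v) (by simp [mem_star]))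
  have hb : verVal χ v.1 v.2 = 0 :=
    (verVal_eq v.1.castSucc v.2).trans (hv (bottomEdge v) (by simp [mem_star]))
  have h1 := potential_up hχ v.1.isLt v.2.isLt.le
  have h2 := potential_right (χ := χ) v.1 v.2
  rw [hl, add_zero] at h1
  rw [hb, add_zero] at h2
  suffices key : ∀ g ∈ star v, edgePotential χ g = potential χ v.1 v.2 by
    rw [key e he, key f hf]
  intro g hg
  rcases mem_star.1 hg with rfl | rfl | rfl | rfl
  exacts [rfl, h2, rfl, h1]

end Potential

/-! ## The black paths -/

section Paths

variable {n s : ℕ} {φ : Edge n → Colour}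

theorem FplAt.eq_or_eq (hφ : IceRule φ) {v : Vertex n} {e f g : Edge n} (he : e ∈ star v)
    (hf : f ∈ star v) (hg : g ∈ star v) (he' : φ e = .b) (hf' : φ f = .b) (hg' : φ g = .b) :
    e = f ∨ e = g ∨ f = g := by
  have h := (hφ v).1
  by_contra! hne
  have hsub : ({e, f, g} : Finset (Edge n)) ⊆ (star v).filter fun e => φ e = Colour.b := by
    intro x hx
    simp only [Finset.mem_insert, Finset.mem_singleton] at hx
    rcases hx with rfl | rfl | rfl <;> simp [*]
  have h1 := Finset.card_le_card hsub
  rw [h, Finset.card_eq_three.2 ⟨e, f, g, hne.1, hne.2.1, hne.2.2, rfl⟩] at h1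
  omega

open Classical in
/-- The indicator function of the black path or cycle through `e`. -/
noncomputable def pathIndicator (φ : Edge n → Colour) (e f : Edge n) : ZMod 2 :=
  if BlackConnected φ e f then 1 else 0

theorem pathIndicator_eq_zero {e f : Edge n} :
    pathIndicator φ e f = 0 ↔ ¬ BlackConnected φ e f := by
  simp [pathIndicator]

theorem BlackConnected.black {e f : Edge n} (h : BlackConnected φ e f) (he : φ e = .b) :
    φ f = .b := by
  rcases Relation.ReflTransGen.cases_tail h with rfl | ⟨_, _, h, h', _⟩
  exacts [he, h']

theorem evenAt_pathIndicator (hφ : IceRule φ) {e : Edge n} (he : φ e = .b) :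
    EvenAt (pathIndicator φ e) := by
  intro v
  have hw : ∀ f, φ f = .w → pathIndicator φ e f = 0 := fun f hf =>
    pathIndicator_eq_zero.2 fun h => by
      have := h.black he
      rw [hf] at this
      cases this
  have hb : ∀ f ∈ star v, ∀ g ∈ star v, φ f = .b → φ g = .b →
      pathIndicator φ e f + pathIndicator φ e g = 0 := by
    intro f hf g hg hf' hg'
    have h : BlackConnected φ e f ↔ BlackConnected φ e g :=
      ⟨fun h => h.trans (BlackConnected.of_star v hf' hg' hf hg), fun h =>
        h.trans (BlackConnected.of_star v hg' hf' hg hf)⟩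
    by_cases hf : BlackConnected φ e f
    · rw [pathIndicator, pathIndicator, if_pos hf, if_pos (h.1 hf)]
      rfl
    · rw [pathIndicator, pathIndicator, if_neg hf, if_neg (h.not.1 hf), add_zero]
  have ml : leftEdge v ∈ star v := by simp [mem_star]
  have mr : rightEdge v ∈ star v := by simp [mem_star]
  have mb : bottomEdge v ∈ star v := by simp [mem_star]
  have mt : topEdge v ∈ star v := by simp [mem_star]
  have hlr := hb _ ml _ mr
  have hlb := hb _ ml _ mb
  have hlt := hb _ ml _ mt
  have hrb := hb _ mr _ mb
  have hrt := hb _ mr _ mt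
  have hbt := hb _ mb _ mt
  have kl := hw (leftEdge v)
  have kr := hw (rightEdge v)
  have kb := hw (bottomEdge v)
  have kt := hw (topEdge v)
  have ht := exists_hasType_iff.1 (iceRule_iff.1 hφ v)
  simp only [HasType] at ht
  cases cl : φ (leftEdge v) <;> cases cr : φ (rightEdge v) <;> cases cb : φ (bottomEdge v) <;>
    cases ct : φ (topEdge v) <;> simp only [cl, cr, cb, ct] at * <;>
    first
    | (exfalso; simp at ht; done)
    | (simp at *; simp [*])

/-- A vertex on a different path already has its two black edges there, so the path of `e` avoids it
and the potential cannot jump. -/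
theorem edgePotential_eq (hφ : IceRule φ) {e : Edge n} (he : φ e = .b) {f g : Edge n}
    (hf : ¬ BlackConnected φ e f) (h : BlackConnected φ f g) :
    edgePotential (pathIndicator φ e) f = edgePotential (pathIndicator φ e) g := by
  induction h with
  | refl => rfl
  | @tail g k hg hk ih =>
    by_cases hgk : g = k
    · rw [ih, hgk]
    rw [ih]
    obtain ⟨h1, h2, v, h3, h4⟩ := hk
    refine edgePotential_eq_of_star (evenAt_pathIndicator hφ he) (fun a ha => ?_) h3 h4
    rw [pathIndicator_eq_zero]
    intro hea
    have hng : ¬ BlackConnected φ e g := fun h => hf (h.trans (BlackConnected.symm hg))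
    have hnk : ¬ BlackConnected φ e k := fun h =>
      hng (h.trans (BlackConnected.of_star v h2 h1 h4 h3))
    rcases FplAt.eq_or_eq hφ h3 h4 ha h1 h2 (hea.black he) with h | rfl | rfl
    exacts [hgk h, hng hea, hnk hea]

/-! ### Counting the ends of a black path. -/

theorem leftEdge_injective : Function.Injective (leftEdge : Vertex n → Edge n) := by
  rintro ⟨a, b⟩ ⟨c, d⟩ h
  simpa [leftEdge] using h

theorem rightEdge_injective : Function.Injective (rightEdge : Vertex n → Edge n) := by
  rintro ⟨a, b⟩ ⟨c, d⟩ h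
  simpa [rightEdge] using h

theorem bottomEdge_injective : Function.Injective (bottomEdge : Vertex n → Edge n) := by
  rintro ⟨a, b⟩ ⟨c, d⟩ h
  simpa [bottomEdge] using h

theorem topEdge_injective : Function.Injective (topEdge : Vertex n → Edge n) := by
  rintro ⟨a, b⟩ ⟨c, d⟩ h
  simpa [topEdge] using h

open Classical in
theorem card_filter_mem_star_le (e : Edge n) :
    (Finset.univ.filter fun v : Vertex n => e ∈ star v).card +
      (if e ∈ Set.range (boundaryEdge (n := n)) then 1 else 0) ≤ 2 := by
  have one : ∀ f : Vertex n → Edge n, Function.Injective f →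
      (Finset.univ.filter fun v => e = f v).card ≤ 1 := fun f hf =>
    Finset.card_le_one.2 fun a ha b hb => hf (by
      simp only [Finset.mem_filter] at ha hb
      exact ha.2.symm.trans hb.2)
  have zero : ∀ f : Vertex n → Edge n, (∀ v, e ≠ f v) →
      (Finset.univ.filter fun v => e = f v).card = 0 := fun f hf => by simp [hf]
  have h1 := one _ leftEdge_injective
  have h2 := one _ rightEdge_injective
  have h3 := one _ bottomEdge_injective
  have h4 := one _ topEdge_injective
  have hle : (Finset.univ.filter fun v : Vertex n => e ∈ star v).card ≤
      (Finset.univ.filter fun v => e = leftEdge v).card +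
      (Finset.univ.filter fun v => e = rightEdge v).card +
      (Finset.univ.filter fun v => e = bottomEdge v).card +
      (Finset.univ.filter fun v => e = topEdge v).card := by
    simp only [mem_star, Finset.filter_or]
    have a := Finset.card_union_le (Finset.univ.filter fun v => e = leftEdge v)
      ((Finset.univ.filter fun v => e = rightEdge v) ∪
      ((Finset.univ.filter fun v => e = bottomEdge v) ∪
      (Finset.univ.filter fun v => e = topEdge v)))
    have b := Finset.card_union_le (Finset.univ.filter fun v => e = rightEdge v)
      ((Finset.univ.filter fun v => e = bottomEdge v) ∪
      (Finset.univ.filter fun v => e = topEdge v))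
    have c := Finset.card_union_le (Finset.univ.filter fun v => e = bottomEdge v)
      (Finset.univ.filter fun v => e = topEdge v)
    omega
  split_ifs with hb
  · obtain ⟨k, rfl⟩ := hb
    rcases boundaryEdge_cases k with ⟨x, -, hx⟩ | ⟨x, -, hx⟩ | ⟨x, -, hx⟩ | ⟨x, -, hx⟩
    · have z1 := zero leftEdge (by simp [hx, leftEdge])
      have z2 := zero rightEdge (by simp [hx, rightEdge])
      have z3 := zero topEdge (by simp [hx, topEdge, Fin.ext_iff])
      omega
    · have z1 := zero leftEdge (by rintro ⟨a, b⟩; simp [hx, leftEdge, Fin.ext_iff]; omega)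
      have z2 := zero bottomEdge (by simp [hx, bottomEdge])
      have z3 := zero topEdge (by simp [hx, topEdge])
      omega
    · have z1 := zero leftEdge (by simp [hx, leftEdge])
      have z2 := zero rightEdge (by simp [hx, rightEdge])
      have z3 := zero bottomEdge (by rintro ⟨a, b⟩; simp [hx, bottomEdge, Fin.ext_iff]; omega)
      omega
    · have z1 := zero rightEdge (by simp [hx, rightEdge, Fin.ext_iff])
      have z2 := zero bottomEdge (by simp [hx, bottomEdge])
      have z3 := zero topEdge (by simp [hx, topEdge])
      omega
  · rcases e with e | e
    · have z1 := zero bottomEdge (by simp [bottomEdge])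
      have z2 := zero topEdge (by simp [topEdge])
      omega
    · have z1 := zero leftEdge (by simp [leftEdge])
      have z2 := zero rightEdge (by simp [rightEdge])
      omega

/-- The graph of consecutive edges on the black path through `e`. -/
def pathGraph (φ : Edge n → Colour) (e : Edge n) : SimpleGraph {f // BlackConnected φ e f} where
  Adj a b := a ≠ b ∧ BlackStep φ a b
  symm := ⟨fun _ _ ⟨h, h1, h2, v, h3, h4⟩ => ⟨h.symm, h2, h1, v, h4, h3⟩⟩
  loopless := ⟨fun _ h => h.1 rfl⟩

theorem connected_pathGraph (e : Edge n) : (pathGraph φ e).Connected := by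
  have key : ∀ f (h : BlackConnected φ e f), (pathGraph φ e).Reachable ⟨e, .refl⟩ ⟨f, h⟩ := by
    intro f h
    induction h with
    | refl => exact .refl _
    | @tail f g hf hg ih =>
      by_cases hfg : f = g
      · subst hfg
        exact ih
      · refine ih.trans (SimpleGraph.Adj.reachable ⟨?_, hg⟩)
        exact fun h => hfg (congrArg Subtype.val h)
  have : Nonempty {f // BlackConnected φ e f} := ⟨⟨e, .refl⟩⟩
  exact ⟨fun a b => (key a a.2).symm.trans (key b b.2)⟩

open Classical in
-- The path graph is connected, so it has at least `V - 1` links between its `V` edges. An edge has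
-- at most one successor through each of its vertices, so the degrees and the number of ends add up
-- to at most `2 V`. Comparing the two bounds leaves at most two ends.
theorem card_ends_le_two (hφ : IceRule φ) {e : Edge n} (he : φ e = .b) :
    (Finset.univ.filter fun k : Fin (4 * n) => BlackConnected φ e (boundaryEdge k)).card ≤ 2 := by
  set G := pathGraph φ e
  have h1 := (connected_pathGraph (φ := φ) e).card_vert_le_card_edgeSet_add_one
  have h2 := G.sum_degrees_eq_twice_card_edges
  have hdeg : ∀ a, G.degree a ≤ (Finset.univ.filter fun v : Vertex n => a.1 ∈ star v).card := by
    intro a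
    rw [← SimpleGraph.card_neighborFinset_eq_degree]
    have hv : ∀ b, G.Adj a b → ∃ v : Vertex n, a.1 ∈ star v ∧ b.1 ∈ star v :=
      fun b hb => hb.2.2.2
    have : Nonempty (Vertex n) := by
      rcases a with ⟨⟨r, _⟩ | ⟨_, r⟩, _⟩
      exacts [⟨(r, r)⟩, ⟨(r, r)⟩]
    choose! f hf using hv
    refine Finset.card_le_card_of_injOn f (fun b hb => ?_) fun b hb c hc hbc => ?_
    · simp only [Finset.coe_filter, Finset.mem_univ, true_and, Set.mem_ofPred_eq]
      exact (hf b (by simpa using hb)).1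
    · have hb' : G.Adj a b := by simpa using hb
      have hc' : G.Adj a c := by simpa using hc
      have hb2 := hf b hb'
      have hc2 := hf c hc'
      rw [← hbc] at hc2
      rcases FplAt.eq_or_eq hφ hb2.1 hb2.2 hc2.2 (a.2.black he) (b.2.black he) (c.2.black he) with
        h | h | h
      · exact absurd (Subtype.ext h) hb'.1
      · exact absurd (Subtype.ext h) hc'.1
      · exact Subtype.ext h
  have hsum : ∑ a, G.degree a + (Finset.univ.filter fun a : {f // BlackConnected φ e f} =>
      a.1 ∈ Set.range (boundaryEdge (n := n))).card ≤
      2 * Fintype.card {f // BlackConnected φ e f} := by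
    rw [Finset.card_filter, ← Finset.sum_add_distrib]
    refine (Finset.sum_le_card_nsmul _ _ 2 fun a _ =>
      (Nat.add_le_add_right (hdeg a) _).trans (card_filter_mem_star_le a.1)).trans ?_
    rw [Finset.card_univ, smul_eq_mul, mul_comm]
  have hends : (Finset.univ.filter fun k : Fin (4 * n) =>
      BlackConnected φ e (boundaryEdge k)).card ≤
      (Finset.univ.filter fun a : {f // BlackConnected φ e f} =>
      a.1 ∈ Set.range (boundaryEdge (n := n))).card := by
    refine Finset.card_le_card_of_injOn
      (fun k => if h : BlackConnected φ e (boundaryEdge k) then ⟨_, h⟩ else ⟨e, .refl⟩)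
      (fun k hk => ?_) fun k hk l hl hkl => ?_
    · have hk' : BlackConnected φ e (boundaryEdge k) := by simpa using hk
      simp [hk']
    · have hk' : BlackConnected φ e (boundaryEdge k) := by simpa using hk
      have hl' : BlackConnected φ e (boundaryEdge l) := by simpa using hl
      simp only [hk', hl', dite_true] at hkl
      exact boundaryEdge_injective (Subtype.ext_iff.1 hkl)
  rw [Nat.card_eq_fintype_card, Nat.card_eq_fintype_card, ← SimpleGraph.edgeFinset_card] at h1
  have h3 : (pathGraph φ e).edgeFinset.card = G.edgeFinset.card := rfl
  omega

/-- The number of ends is at most two, even by `sum_boundaryEdge_eq_zero`, and positive. -/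
theorem exists_other_end (hφ : φ ∈ FplAt n s) {k : Fin (4 * n)} (hk : φ (boundaryEdge k) = .b) :
    ∃ l, l ≠ k ∧ ∀ m, BlackConnected φ (boundaryEdge k) (boundaryEdge m) ↔ m = k ∨ m = l := by
  classical
  set L := Finset.univ.filter fun m : Fin (4 * n) =>
    BlackConnected φ (boundaryEdge k) (boundaryEdge m) with hL
  have h1 : L.card ≤ 2 := card_ends_le_two hφ.1 hk
  have h2 : (L.card : ZMod 2) = 0 := by
    rw [← sum_boundaryEdge_eq_zero (evenAt_pathIndicator hφ.1 hk)]
    simp [pathIndicator, hL]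
  have hkL : k ∈ L := by
    simp only [hL, Finset.mem_filter, Finset.mem_univ, true_and]
    exact .refl
  have h3 : L.card = 2 := by
    have h4 := (ZMod.natCast_eq_zero_iff _ _).1 h2
    have h5 := Finset.card_pos.2 ⟨k, hkL⟩
    omega
  obtain ⟨a, b, hab, hLab⟩ := Finset.card_eq_two.1 h3
  have hmem : ∀ m, BlackConnected φ (boundaryEdge k) (boundaryEdge m) ↔ m = a ∨ m = b := by
    intro m
    have : m ∈ L ↔ m = a ∨ m = b := by simp [hLab]
    rwa [hL, Finset.mem_filter, and_iff_right (Finset.mem_univ _)] at this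
  rcases (hmem k).1 .refl with rfl | rfl
  · exact ⟨b, hab.symm, hmem⟩
  · exact ⟨a, hab, fun m => (hmem m).trans or_comm⟩

/-- A discrete Jordan argument: the potential of the path from `k` to `l` is 1 at `a` and 0 at `b`,
but it is constant along any other path. -/
theorem not_crossing (hφ : φ ∈ FplAt n s) {k l a b : Fin (4 * n)}
    (hk : φ (boundaryEdge k) = .b) (hkl : BlackConnected φ (boundaryEdge k) (boundaryEdge l))
    (hab : BlackConnected φ (boundaryEdge a) (boundaryEdge b)) (h1 : k < a) (h2 : a < l)
    (h3 : l < b) : False := by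
  obtain ⟨l', hne, hl'⟩ := exists_other_end hφ hk
  obtain rfl : l = l' := ((hl' l).1 hkl).resolve_left (by omega)
  have hχ := evenAt_pathIndicator hφ.1 hk
  have ha : ¬ BlackConnected φ (boundaryEdge k) (boundaryEdge a) := by
    rw [hl']
    omega
  have hb : ¬ BlackConnected φ (boundaryEdge k) (boundaryEdge b) := by
    rw [hl']
    omega
  have h4 := edgePotential_eq hφ.1 hk ha hab
  rw [(boundaryPotential_succ hχ a).2 (pathIndicator_eq_zero.2 ha),
    (boundaryPotential_succ hχ b).2 (pathIndicator_eq_zero.2 hb)] at h4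
  have key : ∀ m : Fin (4 * n), boundaryPotential (pathIndicator φ (boundaryEdge k)) m =
      (if k < m then 1 else 0) + (if l < m then 1 else 0) := by
    intro m
    rw [boundaryPotential_eq_sum hχ m.isLt.le]
    have : ∀ i ∈ Finset.range m.val, (if h : i < 4 * n then
        pathIndicator φ (boundaryEdge k) (boundaryEdge ⟨i, h⟩) else 0) =
        (if k.val = i then 1 else 0) + (if l.val = i then 1 else 0) := by
      intro i hi
      have hi' : i < 4 * n := (Finset.mem_range.1 hi).trans m.isLt
      rw [dif_pos hi', pathIndicator]
      simp only [hl', Fin.ext_iff] at hne ⊢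
      split_ifs <;> first | omega | simp
    rw [Finset.sum_congr rfl this, Finset.sum_add_distrib, Finset.sum_ite_eq, Finset.sum_ite_eq]
    simp only [Finset.mem_range, Fin.lt_def]
  rw [key, key, if_pos h1, if_neg (by omega), if_pos (by omega), if_pos h3] at h4
  revert h4
  decide

end Paths

/-! ### Existence of the link pattern. -/

variable {n : ℕ} [NeZero n]

theorem exists_linkedBy {s : Fin 2} {φ : Edge n → Colour} (hφ : φ ∈ FplAt n s) :
    ∃ π, LinkedBy s φ π := by
  let idx : ZMod (2 * n) → Fin (4 * n) := fun u =>
    ⟨2 * u.val + s, by have := ZMod.val_lt u; omega⟩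
  have hidx : ∀ x, endAt s x = boundaryEdge (idx (x - 1)) := fun x => rfl
  have hinj : Function.Injective idx := by
    intro u w h
    have := congrArg Fin.val h
    simp only [idx] at this
    exact ZMod.val_injective _ (by omega)
  have hsurj : ∀ k, φ (boundaryEdge k) = .b → ∃ u, idx u = k := by
    intro k hk
    have h := (hφ.2 k).1 hk
    refine ⟨((k.val / 2 : ℕ) : ZMod (2 * n)), Fin.ext ?_⟩
    simp only [idx]
    rw [ZMod.val_natCast, Nat.mod_eq_of_lt (by omega)]
    omega
  have hblack : ∀ u, φ (boundaryEdge (idx u)) = .b := fun u =>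
    (hφ.2 _).2 (by simp only [idx]; omega)
  have hex : ∀ u, ∃ w, w ≠ u ∧
      ∀ m, BlackConnected φ (boundaryEdge (idx u)) (boundaryEdge (idx m)) ↔ m = u ∨ m = w := by
    intro u
    obtain ⟨l, hl, hl'⟩ := exists_other_end hφ (hblack u)
    obtain ⟨w, rfl⟩ := hsurj l (((hl' l).2 (.inr rfl)).black (hblack u))
    exact ⟨w, fun h => hl (h ▸ rfl), fun m => by rw [hl', hinj.eq_iff, hinj.eq_iff]⟩
  choose p hp hp' using hex
  let ρ : LinkPattern n :=
    { partner := p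
      partner_partner := fun u => by
        have h := ((hp' u (p u)).2 (.inr rfl)).symm
        exact (((hp' (p u) u).1 h).resolve_left (hp u).symm).symm
      partner_ne := hp
      noncrossing := fun x y hxy hyx hcr =>
        not_crossing hφ (hblack x) ((hp' x (p x)).2 (.inr rfl)) ((hp' y (p y)).2 (.inr rfl))
          (by simp only [idx, Fin.lt_def]; omega) (by simp only [idx, Fin.lt_def]; omega)
          (by simp only [idx, Fin.lt_def]; omega) }
  -- `ρ` is indexed by positions counted from 0, in the order of the boundary, where non-crossing is
  -- immediate; the label `x` sits at position `x - 1`.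
  refine ⟨unrotate ρ, fun x y => ?_⟩
  rw [hidx, hidx, hp']
  change p (x - 1) + 1 = y ↔ _
  have h1 := hp (x - 1)
  rw [← eq_sub_iff_add_eq, sub_left_inj, eq_comm (a := y)]
  constructor
  · intro h
    refine ⟨fun hxy => h1 ?_, .inr h.symm⟩
    rw [h, hxy]
  · rintro ⟨h2, h3⟩
    exact (h3.resolve_left h2).symm

/-! ## Exchanging the colours of an alternating cell next to the bottom row -/

/-- Since `p` and `q` differ, the other pair at `v` also contains a black edge. Join `z` to it
inside its non-alternating cell and cross `v`. -/
theorem blackConnected_of_isQuad {n s ε : ℕ} {φ : Edge n → Colour} (hφ : φ ∈ FplAt n s)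
    {v : Vertex n} {p q p' q' z : Edge n} (hq : IsQuad ε v p q p' q') (hp : φ p = .b)
    (hpq : φ p ≠ φ q) (hz : φ z = .b) (hc : cell ε z = cell ε p')
    (ha : ¬ Alt φ (cell ε p')) : BlackConnected φ z p := by
  have hne : φ p' ≠ φ q' := by
    rcases (hq.ice φ).1 (iceRule_iff.1 hφ.1 v) with h | h
    exacts [h.2, absurd h.1 hpq]
  have hpv := (hq.mem p).2 (by simp)
  by_cases h : φ p' = .b
  · exact (blackConnected_of_cell_eq hφ hz h hc (hc ▸ ha)).trans
      (BlackConnected.of_star v h hp ((hq.mem p').2 (by simp)) hpv)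
  · have h' : φ q' = .b := by
      by_contra h'
      exact hne ((Colour.ne_b.1 h).trans (Colour.ne_b.1 h').symm)
    exact (blackConnected_of_cell_eq hφ hz h' (hc.trans hq.cell_eq') (hc ▸ ha)).trans
      (BlackConnected.of_star v h' hp ((hq.mem q').2 (by simp)) hpv)

theorem not_alt_zero {n : ℕ} (φ : Edge n → Colour) (c : ℕ) : ¬ Alt φ (0, c) := by
  rintro ⟨_, _, _, _, h, _⟩
  simp at h

theorem cell_eq_cases {n c : ℕ} {e : Edge n} (hn : 1 < n) (hc : c + 1 < n)
    (h : cell c e = (1, c + 1)) :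
    e = .inl (⟨0, by omega⟩, ⟨c + 1, by omega⟩) ∨ e = .inl (⟨1, hn⟩, ⟨c + 1, by omega⟩) ∨
    e = .inr (⟨1, by omega⟩, ⟨c, by omega⟩) ∨ e = .inr (⟨1, by omega⟩, ⟨c + 1, hc⟩) := by
  rcases cell_cases h with ⟨_, h1, h2, h⟩ | ⟨h1, h2, h⟩ | ⟨_, h1, h2, h⟩ | ⟨h1, h2, h⟩
  exacts [.inl h, .inr (.inl h), .inr (.inr (.inl h)), .inr (.inr (.inr h))]

section Swap

variable {n : ℕ} [NeZero n]

/-- Away from `y`, `y + 1` and their partners the two matchings agree. If `π` lacks the arc, only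
the two former partners are left, and `π'` has to match them with each other. -/
theorem e_eq_of_partner {π π' : LinkPattern n} {y : ZMod (2 * n)} (h : π'.partner y = y + 1)
    (h' : ∀ x, x ≠ y → x ≠ y + 1 → π.partner x ≠ y → π.partner x ≠ y + 1 →
      π'.partner x = π.partner x) : e y π = π' := by
  have h1 := π.partner_partner
  have h2 := π.partner_ne
  have h3 := π'.partner_partner
  have h4 : π'.partner (y + 1) = y := by rw [← h, h3]
  have inj : ∀ a b, π.partner a = b → a = π.partner b := fun a b h => by rw [← h, h1]
  have inj' : ∀ a b, π'.partner a = b → a = π'.partner b := fun a b h => by rw [← h, h3]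
  ext x
  change arcPartner y π.partner x = π'.partner x
  have key : ∀ a b, π.partner y ≠ y + 1 → (a = y ∧ b = y + 1 ∨ a = y + 1 ∧ b = y) →
      π'.partner (π.partner a) = π.partner b := by
    intro a b hy hab
    have hab' : π.partner a ≠ b := by
      intro h5
      rcases hab with ⟨rfl, rfl⟩ | ⟨rfl, rfl⟩
      · exact hy h5
      · exact hy (inj _ _ h5).symm
    by_contra hne
    obtain ⟨z, hz⟩ : ∃ z, π'.partner (π.partner a) = z := ⟨_, rfl⟩
    have hz' := inj' _ _ hz
    have hza : z ≠ a := by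
      rintro rfl
      rcases hab with ⟨rfl, rfl⟩ | ⟨rfl, rfl⟩
      exacts [hab' (hz'.trans h), hab' (hz'.trans h4)]
    have hzb : z ≠ b := by
      rintro rfl
      rcases hab with ⟨rfl, rfl⟩ | ⟨rfl, rfl⟩
      exacts [h2 _ (hz'.trans h4), h2 _ (hz'.trans h)]
    have hpa : π.partner z ≠ a := by
      intro h5
      have h6 := inj _ _ h5
      rw [h6] at hz'
      exact π'.partner_ne _ hz'.symm
    have hpb : π.partner z ≠ b := fun h5 => hne (hz.trans (inj _ _ h5))
    have h6 : π'.partner z = π.partner z := by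
      rcases hab with ⟨rfl, rfl⟩ | ⟨rfl, rfl⟩
      exacts [h' z hza hzb hpa hpb, h' z hzb hza hpb hpa]
    exact hza (by rw [inj _ _ (h6.symm.trans hz'.symm), h1])
  unfold arcPartner
  by_cases hy : π.partner y = y + 1
  · rw [if_pos hy]
    by_cases hx : x = y
    · rw [hx, hy, h]
    by_cases hx' : x = y + 1
    · rw [hx', h4]
      exact (inj _ _ hy).symm
    · refine (h' x hx hx' (fun h5 => hx' ?_) (fun h5 => hx ?_)).symm
      · rw [inj _ _ h5, hy]
      · rw [inj _ _ h5, ← hy, h1]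
  · rw [if_neg hy]
    split_ifs with c1 c2 c3 c4
    · rw [c1, h]
    · rw [c2, h4]
    · rw [c3, key y (y + 1) hy (.inl ⟨rfl, rfl⟩)]
    · rw [c4, key (y + 1) y hy (.inr ⟨rfl, rfl⟩)]
    · exact (h' x c1 c2 (fun h5 => c3 (inj _ _ h5)) (fun h5 => c4 (inj _ _ h5))).symm

theorem e_eq_self {π : LinkPattern n} {y : ZMod (2 * n)} (h : π.partner y = y + 1) :
    e y π = π := by
  ext x
  change arcPartner y π.partner x = π.partner x
  rw [arcPartner, if_pos h]

variable {s : Fin 2} {φ ψ : Edge n → Colour} {c : ℕ} {y : ZMod (2 * n)}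

/-- At the bottom vertex of column `c` the cell `(1, c + 1)` faces the border cell `(0, c)`, which
is never alternating and contains the end `y`. Thus a black edge of the upper cell at this corner
continues to `y`. -/
theorem blackConnected_left (hn : 1 < n) (hc : c + 1 < n) (hφ : φ ∈ FplAt n s)
    (hy : cell c (endAt s y : Edge n) = (0, c)) {p q : Edge n} (hp : φ p = .b)
    (hpq : φ p ≠ φ q)
    (h : p = .inl (⟨0, by omega⟩, ⟨c + 1, by omega⟩) ∧ q = .inr (⟨1, by omega⟩, ⟨c, by omega⟩) ∨
      q = .inl (⟨0, by omega⟩, ⟨c + 1, by omega⟩) ∧ p = .inr (⟨1, by omega⟩, ⟨c, by omega⟩)) :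
    BlackConnected φ (endAt s y) p := by
  have hq := (isQuad_of_even (ε := c) (v := ((⟨0, by omega⟩, ⟨c, by omega⟩) : Vertex n))
    (by simp)).symm
  have hcl := (cell_of_even (ε := c) (v := ((⟨0, by omega⟩, ⟨c, by omega⟩) : Vertex n))
    (by simp)).1
  have ha := not_alt_zero φ c
  rcases h with ⟨rfl, rfl⟩ | ⟨rfl, rfl⟩
  · exact blackConnected_of_isQuad hφ hq hp hpq (endAt_black hφ y) (hy.trans hcl.symm) (hcl ▸ ha)
  · exact blackConnected_of_isQuad hφ hq.swap hp hpq (endAt_black hφ y) (hy.trans hcl.symm)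
      (hcl ▸ ha)

theorem blackConnected_right (hn : 1 < n) (hc : c + 1 < n) (hφ : φ ∈ FplAt n s)
    (hy : cell c (endAt s y : Edge n) = (0, c + 2)) {p q : Edge n} (hp : φ p = .b)
    (hpq : φ p ≠ φ q)
    (h : p = .inl (⟨0, by omega⟩, ⟨c + 1, by omega⟩) ∧ q = .inr (⟨1, by omega⟩, ⟨c + 1, hc⟩) ∨
      q = .inl (⟨0, by omega⟩, ⟨c + 1, by omega⟩) ∧ p = .inr (⟨1, by omega⟩, ⟨c + 1, hc⟩)) :
    BlackConnected φ (endAt s y) p := by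
  have hq := isQuad_of_odd (ε := c) (v := ((⟨0, by omega⟩, ⟨c + 1, hc⟩) : Vertex n))
    (by simp only; omega)
  have hcl := (cell_of_odd (ε := c) (v := ((⟨0, by omega⟩, ⟨c + 1, hc⟩) : Vertex n))
    (by simp only; omega)).2.2.1
  have ha := not_alt_zero φ (c + 2)
  rcases h with ⟨rfl, rfl⟩ | ⟨rfl, rfl⟩
  · exact blackConnected_of_isQuad hφ hq hp hpq (endAt_black hφ y) (hy.trans hcl.symm) (hcl ▸ ha)
  · exact blackConnected_of_isQuad hφ hq.swap hp hpq (endAt_black hφ y) (hy.trans hcl.symm)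
      (hcl ▸ ha)

theorem add_one_ne (y : ZMod (2 * n)) : y ≠ y + 1 := by
  intro h
  have h' := val_add_one_cases y
  rw [← h] at h'
  have := one_lt_two_mul (n := n)
  omega

/-- If the two vertical edges of an alternating cell next to the bottom row are black, then the
exchange of the colours of the cell acts on the link pattern by `e_y`. -/
theorem e_eq_of_vertical (hn : 1 < n) (hc : c + 1 < n) (hφ : φ ∈ FplAt n s)
    (hψ : ψ ∈ FplAt n s) {π π' : LinkPattern n} (hπ : LinkedBy s φ π) (hπ' : LinkedBy s ψ π')
    (hy : cell c (endAt s y : Edge n) = (0, c))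
    (hy' : cell c (endAt s (y + 1) : Edge n) = (0, c + 2))
    (hψφ : ∀ e, cell c e ≠ (1, c + 1) → ψ e = φ e)
    (h1 : φ (.inl (⟨0, by omega⟩, ⟨c + 1, by omega⟩)) = .w)
    (h2 : φ (.inl (⟨1, hn⟩, ⟨c + 1, by omega⟩)) = .w)
    (h3 : φ (.inr (⟨1, by omega⟩, ⟨c, by omega⟩)) = .b)
    (h4 : φ (.inr (⟨1, by omega⟩, ⟨c + 1, hc⟩)) = .b)
    (h1' : ψ (.inl (⟨0, by omega⟩, ⟨c + 1, by omega⟩)) = .b)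
    (h3' : ψ (.inr (⟨1, by omega⟩, ⟨c, by omega⟩)) = .w)
    (h4' : ψ (.inr (⟨1, by omega⟩, ⟨c + 1, hc⟩)) = .w) : e y π = e y π' := by
  have hl := blackConnected_left hn hc hφ hy h3 (by rw [h3, h1]; simp) (.inr ⟨rfl, rfl⟩)
  have hr := blackConnected_right hn hc hφ hy' h4 (by rw [h4, h1]; simp) (.inr ⟨rfl, rfl⟩)
  have hl' := blackConnected_left hn hc hψ hy h1' (by rw [h1', h3']; simp) (.inl ⟨rfl, rfl⟩)
  have hr' := blackConnected_right hn hc hψ hy' h1' (by rw [h1', h4']; simp) (.inl ⟨rfl, rfl⟩)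
  -- In `ψ` the bottom edge of the cell is black and leads to `y` on one side and to `y + 1` on the
  -- other.
  have hp := (hπ' y _).2 ⟨add_one_ne y, hl'.trans hr'.symm⟩
  rw [e_eq_self hp]
  refine e_eq_of_partner hp fun x x1 x2 x3 x4 => ?_
  have hx := (hπ x _).1 rfl
  refine (hπ' x _).2 ⟨hx.1, ?_⟩
  have n1 : ¬ BlackConnected φ (endAt s x) (endAt s y) := fun h => x3 ((hπ x y).2 ⟨x1, h⟩)
  have n2 : ¬ BlackConnected φ (endAt s x) (endAt s (y + 1)) := fun h =>
    x4 ((hπ x (y + 1)).2 ⟨x2, h⟩)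
  -- In `φ` the two black edges of the cell lie on the paths of `y` and `y + 1`, so every other path
  -- avoids the cell and survives in `ψ`.
  have same : ∀ g, BlackConnected φ (endAt s x) g → ψ g = .b := by
    intro g hg
    have hgb := hg.black (endAt_black hφ x)
    rw [hψφ, hgb]
    intro hcell
    rcases cell_eq_cases hn hc hcell with rfl | rfl | rfl | rfl
    · rw [h1] at hgb
      cases hgb
    · rw [h2] at hgb
      cases hgb
    · exact n1 (hg.trans hl.symm)
    · exact n2 (hg.trans hr.symm)
  have key : ∀ g, BlackConnected φ (endAt s x) g → BlackConnected ψ (endAt s x) g := by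
    intro g hg
    induction hg with
    | refl => exact .refl
    | @tail g k hg hk ih =>
      obtain ⟨h5, h6, v, h7, h8⟩ := hk
      exact ih.trans (BlackConnected.of_star v (same g hg)
        (same k (hg.tail ⟨h5, h6, v, h7, h8⟩)) h7 h8)
  exact key _ hx.2

/-- For both values of `k` the border cells `(0, k - 1)` and `(0, k + 1)` diagonally below an
alternating `(1, k)` contain the ends `y` and `y + 1`. One of the two colourings has black vertical
edges in the cell, so `e_eq_of_vertical` applies in one direction or the other. -/
theorem e_eq_of_swapCell {k m : ℕ} (hφ : φ ∈ FplAt n s) {π π' : LinkPattern n}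
    (hπ : LinkedBy s φ π) (hπ' : LinkedBy s (swapCell (1, k) φ) π')
    (hk : k = 2 * m + s + 1 ∨ k = 2 * m + s + 2) (hy : y = (m + 1 : ℕ)) : e y π = e y π' := by
  by_cases hA : Alt φ (1, k)
  swap
  · rw [swapCell_of_not_alt hA] at hπ'
    rw [hπ.unique hπ']
  have hψ := swapCell_mem hφ (1, k)
  have hswap : ∀ e, cell (1 + k) e = (1, k) → swapCell (1, k) φ e = (φ e).flip :=
    fun e he => swapCell_of_alt hA he
  have hsame : ∀ e, cell (1 + k) e ≠ (1, k) → swapCell (1, k) φ e = φ e :=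
    fun e he => swapCell_of_cell_ne he
  generalize swapCell (1, k) φ = ψ at *
  obtain ⟨r, c, hr, hc, hP, c1, c2, c3⟩ := hA
  simp only [Prod.mk.injEq] at hP
  obtain ⟨hr0, rfl⟩ := hP
  obtain rfl : r = 0 := by omega
  have hpar : (1 + (c + 1)) % 2 = c % 2 := by omega
  simp only [cell_congr hpar] at hswap hsame
  simp only [zero_add] at hr c1 c2 c3
  have v1 : ((((m + 1 : ℕ) : ZMod (2 * n)) - 1).val) = m := by
    rw [Nat.cast_add, Nat.cast_one, add_sub_cancel_right, ZMod.val_natCast,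
      Nat.mod_eq_of_lt (by omega)]
  have v2 : ((((m + 1 : ℕ) : ZMod (2 * n)) + 1 - 1).val) = m + 1 := by
    rw [add_sub_cancel_right, ZMod.val_natCast, Nat.mod_eq_of_lt (by omega)]
  have hy1 : cell c (endAt s y : Edge n) = (0, c) := by
    subst hy
    unfold endAt
    simp only [v1]
    rw [boundaryEdge_bottom (n := n) ⟨2 * m + s, by omega⟩, cell_inr]
    simp only [Fin.val_zero, Prod.mk.injEq, true_and]
    omega
  have hy2 : cell c (endAt s (y + 1) : Edge n) = (0, c + 2) := by
    subst hy
    unfold endAt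
    simp only [v2]
    rcases Nat.lt_or_ge (2 * (m + 1) + s) n with h | h
    · rw [boundaryEdge_bottom (n := n) ⟨2 * (m + 1) + s, h⟩, cell_inr]
      simp only [Fin.val_zero, Prod.mk.injEq, true_and]
      omega
    -- The end `y + 1` may already lie on the right side; the cell being inner, it is then the
    -- lowest edge of that side.
    · have h5 : 2 * (m + 1) + s = n + 0 := by omega
      simp only [h5]
      rw [boundaryEdge_right (n := n) ⟨0, by omega⟩, cell_inl]
      simp only [Fin.val_last, Prod.mk.injEq]
      omega
  have m1 := hswap (.inl (⟨0, by omega⟩, ⟨c + 1, by omega⟩))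
    (by rw [cell_inl]; simp only [Prod.mk.injEq, and_true]; omega)
  have m2 := hswap (.inl (⟨1, hr⟩, ⟨c + 1, by omega⟩))
    (by rw [cell_inl]; simp only [Prod.mk.injEq, and_true]; omega)
  have m3 := hswap (.inr (⟨1, by omega⟩, ⟨c, by omega⟩))
    (by rw [cell_inr]; simp only [Prod.mk.injEq, true_and]; omega)
  have m4 := hswap (.inr (⟨1, by omega⟩, ⟨c + 1, hc⟩))
    (by rw [cell_inr]; simp only [Prod.mk.injEq, true_and]; omega)
  rw [← c1] at m2
  rw [← c2] at m4
  by_cases hb : φ (.inr (⟨1, by omega⟩, ⟨c, by omega⟩)) = .b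
  · have hw := Colour.ne_b.1 (hb ▸ c3)
    rw [hb] at m3 m4
    rw [hw] at m1 m2
    exact e_eq_of_vertical hr hc hφ hψ hπ hπ' hy1 hy2 hsame hw (c1 ▸ hw) hb (c2 ▸ hb) m1 m3 m4
  · replace hb := Colour.ne_b.1 hb
    have hw : φ (.inl (⟨0, by omega⟩, ⟨c + 1, by omega⟩)) = .b := by
      by_contra h
      exact c3 ((Colour.ne_b.1 h).trans hb.symm)
    rw [hb] at m3 m4
    rw [hw] at m1 m2
    exact (e_eq_of_vertical hr hc hψ hφ hπ' hπ hy1 hy2 (fun e he => (hsame e he).symm) m1 m2 m3 m4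
      hw hb (c2 ▸ hb)).symm

end Swap

/-! ## Gyrations that preserve the type of a vertex in the bottom row -/

section Step

variable {n : ℕ}

/-- The half gyration of parity `ε` that also exchanges the colours of the cell `(1, k)` when it is
alternating. -/
noncomputable def step (ε k : ℕ) (φ : Edge n → Colour) : Edge n → Colour :=
  gyrate ε (swapCell (1, k) φ)

theorem step_injective (ε k : ℕ) :
    Function.Injective (step ε k : (Edge n → Colour) → Edge n → Colour) :=
  (gyrate_injective ε).comp (swapCell_injective _)

theorem HasType.of_flip {φ ψ : Edge n → Colour} {v : Vertex n} {t : VertexType}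
    (h : HasType φ v t) (hψ : ∀ e ∈ star v, ψ e = (φ e).flip) : HasType ψ v t := by
  have hl := hψ (leftEdge v) (by simp [mem_star])
  have hr := hψ (rightEdge v) (by simp [mem_star])
  have hb := hψ (bottomEdge v) (by simp [mem_star])
  have ht := hψ (topEdge v) (by simp [mem_star])
  cases t <;> simpa [HasType, hl, hr, hb, ht] using h

/-- An alternating cell is flipped by the swap and then kept by the half gyration; for any other
cell it is the reverse. -/
theorem step_of_cell_eq {ε k : ℕ} {φ : Edge n → Colour} {e : Edge n} (hε : (1 + k) % 2 = ε % 2)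
    (he : cell ε e = (1, k)) : step ε k φ e = (φ e).flip := by
  have he' : cell (1 + k) e = (1, k) := by rw [cell_congr hε, he]
  by_cases h : Alt φ (1, k)
  · rw [step, gyrate_of_alt (by rw [he]; exact alt_swapCell.2 h), swapCell_of_alt h he']
  · rw [step, gyrate_of_not_alt (by rw [he]; exact alt_swapCell.not.2 h), swapCell_of_not_alt h]

theorem step_of_cell_eq_zero {ε k c : ℕ} {φ : Edge n → Colour} {e : Edge n}
    (hε : (1 + k) % 2 = ε % 2) (he : cell ε e = (0, c)) : step ε k φ e = (φ e).flip := by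
  have he' : cell (1 + k) e = (0, c) := by rw [cell_congr hε, he]
  rw [step, gyrate_of_not_alt (by rw [he]; exact not_alt_zero _ _),
    swapCell_of_cell_ne (by rw [he']; simp)]

/-- The cells of parity `ε` at this bottom vertex are `(1, k)` and a border cell in row 0. Both are
flipped, so all four edges change colour. -/
theorem HasType.step {ε k : ℕ} {φ : Edge n → Colour} {v : Vertex n} {t : VertexType}
    (h : HasType φ v t) (hv : v.1.val = 0)
    (hk : k = v.2.val ∨ k = v.2.val + 1) (hε : (1 + k) % 2 = ε % 2) :
    HasType (step ε k φ) v t := by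
  refine h.of_flip fun e he => ?_
  rcases hk with rfl | rfl
  · obtain ⟨h1, h2, h3, h4⟩ := cell_of_odd (ε := ε) (v := v) (by omega)
    rw [hv] at h1 h2 h3 h4
    rcases mem_star.1 he with rfl | rfl | rfl | rfl
    exacts [step_of_cell_eq hε h1, step_of_cell_eq_zero hε h3, step_of_cell_eq_zero hε h4,
      step_of_cell_eq hε h2]
  · obtain ⟨h1, h2, h3, h4⟩ := cell_of_even (ε := ε) (v := v) (by omega)
    rw [hv] at h1 h2 h3 h4
    rcases mem_star.1 he with rfl | rfl | rfl | rfl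
    exacts [step_of_cell_eq_zero hε h1, step_of_cell_eq hε h3, step_of_cell_eq_zero hε h2,
      step_of_cell_eq hε h4]

theorem step_mem {s s' ε k : ℕ} {φ : Edge n → Colour} (hφ : φ ∈ FplAt n s)
    (hs : s % 2 ≠ s' % 2) : step ε k φ ∈ FplAt n s' :=
  gyrate_mem (swapCell_mem hφ _) ε hs

/-- In type `a` the cell above and to the right of the vertex is not alternating. -/
theorem HasType.not_alt_of_a {φ : Edge n → Colour} {v : Vertex n} (h : HasType φ v .a)
    (hv : v.1.val = 0) : ¬ Alt φ (1, v.2.val + 1) := by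
  intro hA
  have hq := (isQuad_of_even (ε := v.2.val) (v := v) (by omega)).symm
  obtain ⟨-, -, h3, -⟩ := cell_of_even (ε := v.2.val) (v := v) (by omega)
  rw [hv] at h3
  exact Alt.ne hq (by rwa [h3]) h.2.1

/-- In type `b` the cell above and to the left of the vertex is not alternating. -/
theorem HasType.not_alt_of_b {φ : Edge n → Colour} {v : Vertex n} (h : HasType φ v .b)
    (hv : v.1.val = 0) : ¬ Alt φ (1, v.2.val) := by
  intro hA
  have hq := isQuad_of_odd (ε := v.2.val + 1) (v := v) (by omega)
  obtain ⟨h3, -⟩ := cell_of_odd (ε := v.2.val + 1) (v := v) (by omega)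
  rw [hv] at h3
  exact Alt.ne hq (by rwa [h3]) h.1

end Step

/-! ## Relations between the states -/

section States

variable {n : ℕ} [NeZero n]

/-- The colourings that are counted in the state of type `t` at the column `c`. -/
def typeSet (c : Fin n) (t : VertexType) : Set (Edge n → Colour) :=
  {φ | φ ∈ FplAt n 0 ∧ HasType φ (0, c) t}

/-- The link pattern of a fully-packed loop with the standard boundary condition. -/
noncomputable def linkPattern {c : Fin n} {t : VertexType} (φ : typeSet c t) : LinkPattern n :=
  (exists_linkedBy (s := 0) φ.2.1).choose

theorem linkedBy_linkPattern {c : Fin n} {t : VertexType} (φ : typeSet c t) :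
    LinkedBy 0 φ.1 (linkPattern φ) :=
  (exists_linkedBy (s := 0) φ.2.1).choose_spec

open Classical in
theorem state_eq_sum (c : Fin n) (t : VertexType) :
    state c t = ∑ φ : typeSet c t, Finsupp.single (linkPattern φ) (1 : ℂ) := by
  have h : ∀ π : LinkPattern n, Finsupp.single π (Psi c t π : ℂ) =
      ∑ φ : typeSet c t, if linkPattern φ = π then Finsupp.single π (1 : ℂ) else 0 := by
    intro π
    rw [← Finset.sum_filter, Finset.sum_const, ← Nat.cast_smul_eq_nsmul ℂ, Finsupp.smul_single,
      smul_eq_mul, mul_one]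
    congr 2
    have himg : {φ : Edge n → Colour | φ ∈ Fpl n ∧ HasType φ (0, c) t ∧ HasLinkPattern φ π} =
        Subtype.val '' {φ : typeSet c t | linkPattern φ = π} := by
      ext φ
      constructor
      · rintro ⟨h1, h2, h3⟩
        rw [← fplAt_zero] at h1
        exact ⟨⟨φ, h1, h2⟩, (linkedBy_linkPattern (⟨φ, h1, h2⟩ : typeSet c t)).unique h3, rfl⟩
      · rintro ⟨φ, rfl, rfl⟩
        exact ⟨fplAt_zero n ▸ φ.2.1, φ.2.2, linkedBy_linkPattern φ⟩
    rw [Psi, himg, Set.ncard_image_of_injective _ Subtype.val_injective,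
      Set.ncard_eq_toFinset_card']
    congr 1
    ext φ
    simp
  unfold state
  simp only [h]
  rw [Finset.sum_comm]
  refine Finset.sum_congr rfl fun φ _ => ?_
  rw [Finset.sum_ite_eq, if_pos (Finset.mem_univ _)]

/-- An injective self-map of a finite set is a permutation, so the sum over colourings may be
reindexed by `f` and compared term by term. -/
theorem mapDomain_state_eq {c : Fin n} {t : VertexType} {f : (Edge n → Colour) → Edge n → Colour}
    (hf : Function.Injective f) (hmaps : ∀ φ ∈ typeSet c t, f φ ∈ typeSet c t)
    {g h : LinkPattern n → LinkPattern n}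
    (hgh : ∀ φ ∈ typeSet c t, ∀ π π', LinkedBy 0 φ π → LinkedBy 0 (f φ) π' → g π = h π') :
    Finsupp.lmapDomain ℂ ℂ g (state c t) = Finsupp.lmapDomain ℂ ℂ h (state c t) := by
  classical
  let F : typeSet c t → typeSet c t := fun φ => ⟨f φ.1, hmaps φ.1 φ.2⟩
  have hF : Function.Bijective F := Finite.injective_iff_bijective.1 fun φ ψ h =>
    Subtype.ext (hf (congrArg Subtype.val h))
  have hsum := hF.sum_comp fun φ =>
    Finsupp.lmapDomain ℂ ℂ h (Finsupp.single (linkPattern φ) (1 : ℂ))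
  rw [state_eq_sum, map_sum, map_sum, ← hsum]
  refine Finset.sum_congr rfl fun φ _ => ?_
  rw [Finsupp.lmapDomain_apply, Finsupp.lmapDomain_apply, Finsupp.mapDomain_single,
    Finsupp.mapDomain_single,
    hgh φ.1 φ.2 _ _ (linkedBy_linkPattern φ) (linkedBy_linkPattern (F φ))]

/-! ### The operators as maps of basis vectors, and the gyration relations. -/

theorem eOp_eq (j : ZMod (2 * n)) : eOp j = Finsupp.lmapDomain ℂ ℂ (e j) := rfl

theorem ROp_lmapDomain (g : LinkPattern n → LinkPattern n) (x : LPSpace n) :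
    ROp (Finsupp.lmapDomain ℂ ℂ g x) = Finsupp.lmapDomain ℂ ℂ (fun π => R (g π)) x := by
  rw [ROp, Finsupp.domLCongr_apply, Finsupp.domCongr_apply, Finsupp.equivMapDomain_eq_mapDomain,
    Finsupp.lmapDomain_apply, Finsupp.lmapDomain_apply, ← Finsupp.mapDomain_comp]
  rfl

theorem ROp_symm_lmapDomain (g : LinkPattern n → LinkPattern n) (x : LPSpace n) :
    ROp.symm (Finsupp.lmapDomain ℂ ℂ g x) = Finsupp.lmapDomain ℂ ℂ (fun π => R.symm (g π)) x := by
  rw [LinearEquiv.symm_apply_eq, ROp_lmapDomain]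
  simp

theorem e_R (j : ZMod (2 * n)) (π : LinkPattern n) : e (j - 1) (R π) = R (e j π) := by
  ext x
  change arcPartner (j - 1) (fun x => π.partner (x + 1) - 1) x =
    arcPartner j π.partner (x + 1) - 1
  have h1 : π.partner j - 1 = j ↔ π.partner j = j + 1 := sub_eq_iff_eq_add
  have h2 : ∀ y, x = y - 1 ↔ x + 1 = y := fun y => eq_sub_iff_add_eq
  have h3 : x = j ↔ x + 1 = j + 1 := (add_left_inj 1).symm
  simp only [arcPartner, sub_add_cancel, h1, h2, h3]
  split_ifs <;> simp only [add_sub_cancel_right]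

theorem e_R_symm (j : ZMod (2 * n)) (π : LinkPattern n) :
    e (j + 1) (R.symm π) = R.symm (e j π) := by
  rw [Equiv.eq_symm_apply, ← e_R, add_sub_cancel_right, Equiv.apply_symm_apply]

/-- With `π₁` after the first swap and `π₂` after the second, the chain is `e_j π = e_j π₁ = R⁻¹
e_{j-1} R π₁ = R⁻¹ e_{j-1} π₂`. Both steps keep every type. -/
theorem odd_relation {j : ℕ} (hj : 1 ≤ j) {c : Fin n} (hc : c.val = 2 * j - 2) (t : VertexType) :
    eOp (j : ZMod (2 * n)) (state c t) =
      ROp.symm (eOp ((j : ZMod (2 * n)) - 1) (state c t)) := by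
  rw [eOp_eq, eOp_eq, ROp_symm_lmapDomain]
  refine mapDomain_state_eq ((step_injective 1 c.val).comp (step_injective 0 (c.val + 1)))
    (fun φ hφ => ⟨step_mem (s := 1) (step_mem hφ.1 (by simp)) (by simp), ?_⟩)
    fun φ hφ π π' hπ hπ' => ?_
  · exact (hφ.2.step (by simp) (.inr rfl) (by dsimp only; omega)).step (by simp) (.inl rfl)
      (by omega)
  · have m0 : φ ∈ FplAt n (0 : Fin 2) := hφ.1
    obtain ⟨π₁, h1⟩ := exists_linkedBy (swapCell_mem m0 (1, c.val + 1))
    have h2 := h1.gyrate_zero (swapCell_mem m0 (1, c.val + 1))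
    have m1 : step 0 (c.val + 1) φ ∈ FplAt n (1 : Fin 2) := step_mem m0 (by simp)
    obtain ⟨π₂, h3⟩ := exists_linkedBy (swapCell_mem m1 (1, c.val))
    have h4 := h3.gyrate_one (swapCell_mem m1 (1, c.val)) (s' := 0) (by decide)
    obtain rfl := hπ'.unique h4
    have h5 : e (j : ZMod (2 * n)) π = e (j : ZMod (2 * n)) π₁ :=
      e_eq_of_swapCell (m := j - 1) m0 hπ h1 (.inl (by simp; omega)) (by congr; omega)
    rw [h5, Equiv.eq_symm_apply, ← e_R]
    -- For the leftmost vertex the second cell is `(1, 0)` on the border, so nothing is swapped;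
    -- this also avoids the truncated index `j - 2`.
    by_cases hj' : j = 1
    · have h6 : ¬ Alt (step 0 (c.val + 1) φ) (1, c.val) := by
        rintro ⟨_, _, _, _, h, _⟩
        simp only [Prod.mk.injEq] at h
        omega
      rw [swapCell_of_not_alt h6] at h3
      rw [h3.unique h2]
    · exact e_eq_of_swapCell (m := j - 2) m1 h2 h3 (.inl (by simp; omega))
        (by rw [sub_eq_iff_eq_add]; norm_cast; congr; omega)

/-- In type `a` the cell `(1, c + 1)` is not alternating, so the plain half gyration of parity 1
already keeps the type. Only the swap at parity 0 remains, and `e_j` absorbs it. -/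
theorem even_relation_a {j : ℕ} (hj : 1 ≤ j) {c : Fin n} (hc : c.val = 2 * j - 1) :
    eOp (j : ZMod (2 * n)) (state c .a) =
      ROp.symm (eOp ((j : ZMod (2 * n)) - 1) (state c .a)) := by
  rw [eOp_eq, eOp_eq, ROp_symm_lmapDomain]
  refine mapDomain_state_eq ((gyrate_injective 1).comp (step_injective 0 c.val))
    (fun φ hφ => ?_) fun φ hφ π π' hπ hπ' => ?_
  · have h1 : HasType (step 0 c.val φ) (0, c) .a := hφ.2.step (by simp) (.inl rfl) (by omega)
    have h2 := h1.step (ε := 1) (k := c.val + 1) (by simp) (.inr rfl) (by omega)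
    rw [step, swapCell_of_not_alt (h1.not_alt_of_a (by simp))] at h2
    exact ⟨gyrate_mem (s := 1) (step_mem hφ.1 (by simp)) _ (by simp), h2⟩
  · have m0 : φ ∈ FplAt n (0 : Fin 2) := hφ.1
    obtain ⟨π₁, h1⟩ := exists_linkedBy (swapCell_mem m0 (1, c.val))
    have h2 := h1.gyrate_zero (swapCell_mem m0 (1, c.val))
    have m1 : step 0 c.val φ ∈ FplAt n (1 : Fin 2) := step_mem m0 (by simp)
    have h4 := h2.gyrate_one m1 (s' := 0) (by decide)
    obtain rfl := hπ'.unique h4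
    have h5 : e (j : ZMod (2 * n)) π = e (j : ZMod (2 * n)) π₁ :=
      e_eq_of_swapCell (m := j - 1) m0 hπ h1 (.inl (by simp; omega)) (by congr; omega)
    rw [h5, Equiv.eq_symm_apply, ← e_R]

/-- In type `b` it is the cell `(1, c)` of parity 0 that is not alternating. Hence parity 1 comes
first, with the swap, and the final half gyration of parity 0 starts from the opposite boundary
condition, where it acts as `R⁻¹`. -/
theorem even_relation_b {j : ℕ} (hj : 1 ≤ j) {c : Fin n} (hc : c.val = 2 * j - 1) :
    eOp (j : ZMod (2 * n)) (state c .b) =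
      ROp (eOp ((j : ZMod (2 * n)) + 1) (state c .b)) := by
  rw [eOp_eq, eOp_eq, ROp_lmapDomain]
  refine mapDomain_state_eq ((gyrate_injective 0).comp (step_injective 1 (c.val + 1)))
    (fun φ hφ => ?_) fun φ hφ π π' hπ hπ' => ?_
  · have h1 : HasType (step 1 (c.val + 1) φ) (0, c) .b :=
      hφ.2.step (by simp) (.inr rfl) (by omega)
    have h2 := h1.step (ε := 0) (k := c.val) (by simp) (.inl rfl) (by omega)
    rw [step, swapCell_of_not_alt (h1.not_alt_of_b (by simp))] at h2
    exact ⟨gyrate_mem (s := 1) (step_mem hφ.1 (by simp)) _ (by simp), h2⟩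
  · have m0 : φ ∈ FplAt n (0 : Fin 2) := hφ.1
    obtain ⟨π₁, h1⟩ := exists_linkedBy (swapCell_mem m0 (1, c.val + 1))
    have h2 := h1.gyrate_one (swapCell_mem m0 (1, c.val + 1)) (s' := 1) (by decide)
    have m1 : step 1 (c.val + 1) φ ∈ FplAt n (1 : Fin 2) := step_mem m0 (by simp)
    have h4 := h2.gyrate_zero' m1
    obtain rfl := hπ'.unique h4
    have h5 : e (j : ZMod (2 * n)) π = e (j : ZMod (2 * n)) π₁ :=
      e_eq_of_swapCell (m := j - 1) m0 hπ h1 (.inr (by simp; omega)) (by congr; omega)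
    rw [h5, e_R_symm, Equiv.apply_symm_apply]

end States
end FPL

theorem mainTheorem5 (n : ℕ) [NeZero n] :
    (∀ (j : ℕ) (h₁ : 1 ≤ j) (h₂ : j ≤ (n + 1) / 2),
      FPL.eOp (j : ZMod (2 * n)) (FPL.oddState .a j h₁ h₂) =
          FPL.ROp.symm (FPL.eOp ((j : ZMod (2 * n)) - 1) (FPL.oddState .a j h₁ h₂)) ∧
      FPL.eOp (j : ZMod (2 * n)) (FPL.oddState .b j h₁ h₂) =
          FPL.ROp.symm (FPL.eOp ((j : ZMod (2 * n)) - 1) (FPL.oddState .b j h₁ h₂)) ∧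
      FPL.eOp (j : ZMod (2 * n)) (FPL.oddState .c j h₁ h₂) =
          FPL.ROp.symm (FPL.eOp ((j : ZMod (2 * n)) - 1) (FPL.oddState .c j h₁ h₂))) ∧
    (∀ (j : ℕ) (h₁ : 1 ≤ j) (h₂ : j ≤ n / 2),
      FPL.eOp (j : ZMod (2 * n)) (FPL.evenState .a j h₁ h₂) =
          FPL.ROp.symm (FPL.eOp ((j : ZMod (2 * n)) - 1) (FPL.evenState .a j h₁ h₂)) ∧
      FPL.eOp (j : ZMod (2 * n)) (FPL.evenState .b j h₁ h₂) =
          FPL.ROp (FPL.eOp ((j : ZMod (2 * n)) + 1) (FPL.evenState .b j h₁ h₂))) :=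
  ⟨fun _ h₁ _ => ⟨FPL.odd_relation h₁ (Nat.sub_sub _ 1 1) _,
    FPL.odd_relation h₁ (Nat.sub_sub _ 1 1) _, FPL.odd_relation h₁ (Nat.sub_sub _ 1 1) _⟩,
    fun _ h₁ _ => ⟨FPL.even_relation_a h₁ rfl, FPL.even_relation_b h₁ rfl⟩⟩
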